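/- Let $\sigma_0>0$ and $\mu_0\in\mathbb R^m$, let $L$ be an open neighbourhood of $(\mu_0,\sigma_0)$ in $\mathbb R^m\times\mathbb R$, and let $u_0,v_0,Y_0>0$. For $(\mu,\sigma)\in L$ consider a vector field $X_{\mu,\sigma}$ on $\mathbb R^3\ni(u,v,Y)$, with first integral $\nu=uv$, of one of the following normal forms. (a) If $\sigma_0\notin\mathbb Q$: $\ \dot u=u,\ \dot v=-v,\ \dot Y=-(\sigma+\varphi_{\mu,\sigma}(\nu))Y$. (b) If $\sigma_0=p/q$ with coprime integers $p,q\ge 1$ (so $q=1$ exactly when $\sigma_0\in\mathbb N$): $\ \dot u=u,\ \dot v=-v,\ \dot Y=-(\sigma+\varphi_{\mu,\sigma}(\nu))Y+\Phi_{\mu,\sigma}(\nu,u^pY^q)Y+v^p\eta_{\mu,\sigma}(\nu)$. Here $\varphi_{\mu,\sigma},\eta_{\mu,\sigma}$ (in one variable) and $\Phi_{\mu,\sigma}$ (in two variables) are polynomials of degree at most some $K$ independent of $(\mu,\sigma)$, with coefficients $C^\infty$ in $(\mu,\sigma)\in L$, such that $\varphi_{\mu,\sigma}(0)=0$, $\Phi_{\mu,\sigma}(\nu,0)\equiv0$,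 and $\eta_{\mu,\sigma}\equiv 0$ if $\sigma_0\notin\mathbb N$. Put $$\bar\sigma=\sigma+\varphi_{\mu,\sigma}(\nu),\qquad \alpha=\bar\sigma-\sigma_0,\qquad \omega(\xi,\alpha)=\begin{cases}\dfrac{\xi^{-\alpha}-1}{\alpha},&\alpha\ne0,\\[1ex]-\ln\xi,&\alpha=0,\end{cases}\quad(\xi>0),$$ and $\Pi=\{u=u_0,\ 0\le v\le v_0,\ |Y|\le Y_0\}$. Then there are $0<u_1<u_0$, $v_1>0$, $Y_1>0$ and a neighbourhood $N\subset L$ of $(\mu_0,\sigma_0)$ such that for all $(\mu,\sigma)\in N$, $0<u<u_1$, $0\le v<v_1$, $|Y|<Y_1$, the trajectory of $X_{\mu,\sigma}$ through $(u,v,Y)$ reaches $\Pi$ after a finite positive time; its first point on $\Pi$ is $(u_0,\nu/u_0,\widetilde Y_{\mu,\sigma}(u,v,Y))$ with $\nu=uv$, where 1. in case (a), $\displaystyle \widetilde Y_{\mu,\sigma}(u,v,Y)=\Big(\frac u{u_0}\Big)^{\bar\sigma}Y$; 2. in case (b), $$\widetilde Y_{\mu,\sigma}(u,v,Y)=\eta_{\mu,\sigma}(\nu)\,v^p\Big(\frac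 u{u_0}\Big)^{\bar\sigma}\omega\Big(\frac u{u_0},\alpha\Big)+\Big(\frac u{u_0}\Big)^{\bar\sigma}\big(Y+\phi_{\mu,\sigma}(Y,u,v)\big),$$ and the family $\phi_{\mu,\sigma}$ has the following properties. * There is a constant $C$ with $|\phi_{\mu,\sigma}(Y,u,v)|\le C\,u^{p+q\alpha}\,\omega\big(\tfrac u{u_0},\alpha\big)^{q+1}|\ln u|$ for all these $(\mu,\sigma),u,v,Y$. * For every integer $l\ge2$, $\phi_{\mu,\sigma}$ is of class $C^{l-2}$ in $\big(Y,u^{1/l},u^{1/l}\omega(\tfrac u{u_0},\alpha),v,\mu,\sigma\big)$, in the following sense: there are $0<u_2\le u_1$, a neighbourhood $N_2\subset N$ of $(\mu_0,\sigma_0)$, an open set $O\subset\mathbb R^4\times\mathbb R^m\times\mathbb R$ containing all points $(Y,0,0,v,\mu_0,\sigma_0)$ with $|Y|<Y_1$, $0\le v<v_1$, and a $C^{l-2}$ function $g:O\to\mathbb R$, such that for $(\mu,\sigma)\in N_2$, $0<u<u_2$, $0\le v<v_1$, $|Y|<Y_1$ the point $\big(Y,u^{1/l},u^{1/l}\omega(\tfrac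 u{u_0},\alpha),v,\mu,\sigma\big)$ lies in $O$ and $\phi_{\mu,\sigma}(Y,u,v)$ is the value of $g$ at it. These results restrict to the two types of sections, as follows (the constants $C$, neighbourhoods and functions $g$ may depend on the section). *Type I.* Let $0<\rho_0<v_1$ and $\nu_0=u_0\rho_0$. The transition from the section $\{v=\rho_0\}$, parametrized by $(Y,\nu)$ with $|Y|<Y_1$, $0<\nu<u_1\rho_0$ (starting point $(\nu/\rho_0,\rho_0,Y)$), to $\Pi$ has $Y$-component $(\nu/\nu_0)^{\bar\sigma}Y$ in case (a), and in case (b) $$\eta_{\mu,\sigma}(\nu)\rho_0^p\Big(\frac\nu{\nu_0}\Big)^{\bar\sigma}\omega\Big(\frac\nu{\nu_0},\alpha\Big)+\Big(\frac\nu{\nu_0}\Big)^{\bar\sigma}\big(Y+\phi\big),\qquad \phi=\phi_{\mu,\sigma}(Y,\nu/\rho_0,\rho_0),$$ where $|\phi|\le C\nu^{p+q\alpha}\omega(\tfrac\nu{\nu_0},\alpha)^{q+1}|\ln\nu|$ and, for every $l\ge2$, $\phi$ is of class $C^{l-2}$ in $\big(Y,\nu^{1/l},\nu^{1/l}\omega(\tfrac\nu{\nu_0},\alpha),\nu,\mu,\sigma\big)$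 near the points $(Y,0,0,0,\mu_0,\sigma_0)$, $|Y|<Y_1$, in the same sense. *Type II.* Let $|Y_c|<Y_1$. The transition from the section $\{Y=Y_c\}$, parametrized by $(u,v)$, to $\Pi$ has $Y$-component $(u/u_0)^{\bar\sigma}Y_c$ in case (a), and the formula of 2. with $Y=Y_c$ in case (b); there $\phi=\phi_{\mu,\sigma}(Y_c,u,v)$ satisfies $|\phi|\le C u^{p+q\alpha}\omega(\tfrac u{u_0},\alpha)^{q+1}|\ln u|$ and, for every $l\ge2$, is of class $C^{l-2}$ in $\big(u^{1/l},u^{1/l}\omega(\tfrac u{u_0},\alpha),v,\mu,\sigma\big)$ near the points $(0,0,v,\mu_0,\sigma_0)$, $0\le v<v_1$, in the same sense. -/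

import Mathlib

open Set Filter Topology Polynomial
open scoped ContDiff

noncomputable section

namespace DulacSaddle

/-- The parameter space: `P = (μ, σ)` with `μ` in a Euclidean space and `σ` real. -/
abbrev Param (m : ℕ) : Type := EuclideanSpace ℝ (Fin m) × ℝ

/-- A family of real polynomials of degree at most `K`, with coefficients that are smooth
in the parameter on the set `L`. -/
def IsSmoothPolyFamily {m : ℕ} (L : Set (Param m)) (K : ℕ) (f : Param m → ℝ[X]) : Prop :=
  (∀ P ∈ L, (f P).natDegree ≤ K) ∧
    ∀ i : ℕ, ContDiffOn ℝ ∞ (fun P => (f P).coeff i) L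

/-- The same for families of polynomials in two variables. -/
def IsSmoothPolyFamily₂ {m : ℕ} (L : Set (Param m)) (K : ℕ)
    (f : Param m → MvPolynomial (Fin 2) ℝ) : Prop :=
  (∀ P ∈ L, (f P).totalDegree ≤ K) ∧
    ∀ i : Fin 2 →₀ ℕ, ContDiffOn ℝ ∞ (fun P => (f P).coeff i) L

/-- `σ̄ = σ + φ_{μ,σ}(ν)`. -/
def sigmaBar {m : ℕ} (φ : Param m → ℝ[X]) (P : Param m) (ν : ℝ) : ℝ :=
  P.2 + (φ P).eval ν

/-- `α = σ̄ - σ₀`. -/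
def alpha {m : ℕ} (σ₀ : ℝ) (φ : Param m → ℝ[X]) (P : Param m) (ν : ℝ) : ℝ :=
  sigmaBar φ P ν - σ₀

/-- The normal form for irrational `σ₀`:
`u' = u`, `v' = -v`, `Y' = -(σ + φ(ν)) Y` with `ν = u v`, in the coordinates `(u, v, Y)`. -/
def nonresonantField {m : ℕ} (φ : Param m → ℝ[X]) (P : Param m) (x : ℝ × ℝ × ℝ) : ℝ × ℝ × ℝ :=
  (x.1, -x.2.1, -(sigmaBar φ P (x.1 * x.2.1)) * x.2.2)

/-- The normal form for `σ₀ = p / q`: `u' = u`, `v' = -v`,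
`Y' = -(σ + φ(ν)) Y + Φ(ν, u ^ p Y ^ q) Y + v ^ p η(ν)` with `ν = u v`. -/
def resonantField {m : ℕ} (p q : ℕ) (φ : Param m → ℝ[X])
    (Φ : Param m → MvPolynomial (Fin 2) ℝ) (η : Param m → ℝ[X]) (P : Param m)
    (x : ℝ × ℝ × ℝ) : ℝ × ℝ × ℝ :=
  (x.1, -x.2.1,
    -(sigmaBar φ P (x.1 * x.2.1)) * x.2.2
      + MvPolynomial.eval ![x.1 * x.2.1, x.1 ^ p * x.2.2 ^ q] (Φ P) * x.2.2
      + x.2.1 ^ p * (η P).eval (x.1 * x.2.1))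

/-- Admissible coefficients of the normal form for irrational `σ₀`. The linear part at the origin
is `diag(1, -1, -σ)`, i.e. `φ(0) = 0`. -/
structure IsNonresonantFamily {m : ℕ} (L : Set (Param m)) (K : ℕ) (φ : Param m → ℝ[X]) :
    Prop where
  smooth_phi : IsSmoothPolyFamily L K φ
  phi_zero : ∀ P ∈ L, (φ P).eval 0 = 0

/-- Admissible coefficients of the normal form for `σ₀ = p / q`; the term `η` is present only for
integer `σ₀`, i.e. `q = 1`. -/
structure IsResonantFamily {m : ℕ} (q : ℕ) (L : Set (Param m)) (K : ℕ)
    (φ : Param m → ℝ[X]) (Φ : Param m → MvPolynomial (Fin 2) ℝ) (η : Param m → ℝ[X]) :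
    Prop where
  smooth_phi : IsSmoothPolyFamily L K φ
  phi_zero : ∀ P ∈ L, (φ P).eval 0 = 0
  smooth_Phi : IsSmoothPolyFamily₂ L K Φ
  Phi_zero : ∀ P ∈ L, ∀ ν : ℝ, MvPolynomial.eval ![ν, 0] (Φ P) = 0
  smooth_eta : IsSmoothPolyFamily L K η
  eta_zero : q ≠ 1 → ∀ P ∈ L, η P = 0

/-- The compensator `ω(ξ, α)`, for `ξ > 0`. -/
def compensator (ξ α : ℝ) : ℝ :=
  if α = 0 then -Real.log ξ else (ξ ^ (-α) - 1) / α

/-- The section `{u = u₀, 0 ≤ v ≤ v₀, |Y| ≤ Y₀}`. -/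
def outSection (u₀ v₀ Y₀ : ℝ) : Set (ℝ × ℝ × ℝ) :=
  {x | x.1 = u₀ ∧ x.2.1 ∈ Icc 0 v₀ ∧ x.2.2 ∈ Icc (-Y₀) Y₀}

/-- The trajectory of `X` that starts at `x` reaches `S` after a finite positive time, for the
first time at the point `z`. -/
def IsTransition (X : ℝ × ℝ × ℝ → ℝ × ℝ × ℝ) (S : Set (ℝ × ℝ × ℝ)) (x z : ℝ × ℝ × ℝ) : Prop :=
  ∃ T : ℝ, 0 < T ∧ ∃ γ : ℝ → ℝ × ℝ × ℝ,
    IsIntegralCurveOn γ (fun _ => X) (Icc 0 T) ∧ γ 0 = x ∧ γ T = z ∧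
      z ∈ S ∧ ∀ t ∈ Ico 0 T, γ t ∉ S

/-- The trajectory of `X` through `(u, v, Y)` reaches the section in exactly one first point; this
point has first integral `ν = u v` (i.e. `v`-coordinate `u v / u₀`) and `Y`-component `Yt`. -/
def HasTransition (X : ℝ × ℝ × ℝ → ℝ × ℝ × ℝ) (u₀ v₀ Y₀ u v Y Yt : ℝ) : Prop :=
  ∀ z : ℝ × ℝ × ℝ,
    IsTransition X (outSection u₀ v₀ Y₀) (u, v, Y) z ↔ z = (u₀, u * v / u₀, Yt)

/-- On `D`, the function `f` is a function of class `C ^ n` of the variables `M : A → F`: it is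
`g ∘ M` with `g` of class `C ^ n` on an open set of `F` that contains the values of `M` on `D` and
the set `B`. -/
def IsCkInVariables {A F : Type*} [NormedAddCommGroup F] [NormedSpace ℝ F] (n : ℕ)
    (f : A → ℝ) (M : A → F) (D : Set A) (B : Set F) : Prop :=
  ∃ O : Set F, IsOpen O ∧ B ⊆ O ∧ MapsTo M D O ∧
    ∃ g : F → ℝ, ContDiffOn ℝ n g O ∧ ∀ a ∈ D, f a = g (M a)

end DulacSaddle

end

open DulacSaddle

/-! ### Functions a^M (log a)^k f(α log a) that are flat at a = 0 -/

section FlatFunctions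

variable {A : Type*} [NormedAddCommGroup A] [NormedSpace ℝ A]

/-! Along a trajectory u grows like e^t and v decays like e^(-t), so ν = uv is constant, the flight
time to u = u₀ is T = log(u₀/u), and only a scalar equation for Y remains. For irrational σ₀ it is
linear. In the resonant case write Y(t) = e^(-σ̄t) Z(t) with Z(t) = Y + κ ∫_0^t e^(ατ) dτ + R(t) and
κ = v^p η(ν). Since qσ̄ = p + qα, this absorbs the linear part and the η-term; at t = T the integral
is the compensator ω, and R solves R' = Φ(ν, u^p e^(-qαt) Z^q) Z with R(0) = 0. The remainder of the
transition is R(T) (`IsRemainder.isFiberSolution`).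

Smoothness. Rescale time to [0,1] and read the equation for R as a fixed-point equation in C([0,1]).
With u = u₀ a^l its coefficients contain functions a^M (log a)^k f(α log a), where f grows at most
exponentially, and M ≥ l because Φ(ν,0) = 0 leaves at least one factor u^p. As α is close to 0,
these functions, extended by zero to a ≤ 0, are C^(l-1) (`contDiffAt_flatLog`). At a = 0 the
nonlinear term vanishes, so the implicit function theorem yields R as a C^(l-1) function of (Y, a,
v, μ, σ) (`exists_local_remainder`). Thus g need not depend on the compensator variable at all.
Uniqueness of trajectories makes R(T) independent of l (`IsRemainder.transRemainder_eq`), and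
compactness in (Y, v) makes the neighbourhoods uniform (`eventually_uniform`).

Estimate. If ‖R‖ ≤ 1, then |Z(t)| is at most a constant times 1 + ∫_0^t e^(ατ) dτ. Both this
quantity and its product with e^(-αt) are controlled by their counterparts at time T, so the
integrand is O(u^p e^(-qαT) ω^(q+1)); integration over a time of length T gives the logarithm
(`abs_remainderField_le`). -/

/-- Smooth functions on the line all of whose derivatives are `O (exp (c |x|))`. -/
def ExpGrowth (c : ℝ) (f : ℝ → A) : Prop :=
  ContDiff ℝ ∞ f ∧ ∀ k : ℕ, ∃ C : ℝ, ∀ x, ‖iteratedDeriv k f x‖ ≤ C * Real.exp (c * |x|)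

lemma ExpGrowth.deriv {c : ℝ} {f : ℝ → A} (hf : ExpGrowth c f) : ExpGrowth c (deriv f) := by
  refine ⟨(contDiff_infty_iff_deriv.1 hf.1).2, fun k => ?_⟩
  obtain ⟨C, hC⟩ := hf.2 (k + 1)
  exact ⟨C, fun x => by rw [← iteratedDeriv_succ']; exact hC x⟩

lemma ExpGrowth.hasDerivAt {c : ℝ} {f : ℝ → A} (hf : ExpGrowth c f) (x : ℝ) :
    HasDerivAt f (_root_.deriv f x) x :=
  ((hf.1.differentiable (by simp)) x).hasDerivAt

lemma ExpGrowth.exists_bound {c : ℝ} {f : ℝ → A} (hf : ExpGrowth c f) :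
    ∃ C : ℝ, 0 ≤ C ∧ ∀ x, ‖f x‖ ≤ C * Real.exp (c * |x|) := by
  obtain ⟨C, hC⟩ := hf.2 0
  simp only [iteratedDeriv_zero] at hC
  refine ⟨C, ?_, hC⟩
  have := (norm_nonneg _).trans (hC 0)
  simpa using this

/-- The function `a ^ M * (log a) ^ k * f (α log a)` of `(a, α)`, extended by zero to `a ≤ 0`. -/
noncomputable def flatLog (M k : ℕ) (f : ℝ → A) (x : ℝ × ℝ) : A :=
  if 0 < x.1 then (x.1 ^ M * Real.log x.1 ^ k) • f (x.2 * Real.log x.1) else 0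

lemma flatLog_of_pos {M k : ℕ} {f : ℝ → A} {x : ℝ × ℝ} (hx : 0 < x.1) :
    flatLog M k f x = (x.1 ^ M * Real.log x.1 ^ k) • f (x.2 * Real.log x.1) := if_pos hx

lemma flatLog_of_nonpos {M k : ℕ} {f : ℝ → A} {x : ℝ × ℝ} (hx : x.1 ≤ 0) :
    flatLog M k f x = 0 := if_neg hx.not_gt

lemma tendsto_rpow_mul_abs_log_pow {ε : ℝ} (hε : 0 < ε) (k : ℕ) :
    Tendsto (fun a : ℝ => a ^ ε * |Real.log a| ^ k) (𝓝[>] 0) (𝓝 0) := by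
  have h := isLittleO_abs_log_rpow_rpow_nhdsGT_zero (s := -ε) (k : ℝ) (by linarith)
  refine h.tendsto_div_nhds_zero.congr' ?_
  filter_upwards [self_mem_nhdsWithin] with a ha
  rw [Real.rpow_neg (le_of_lt ha), div_inv_eq_mul, Real.rpow_natCast, mul_comm]

/-- One power of a pays for everything else: for a < 1 and |α| < δ the profile is at most C a^(-cδ),
and a^(1-cδ) |log a|^k still tends to 0. The factor |a|^M that is left over serves differentiability
at a = 0. -/
lemma exists_flatLog_bound {c δ : ℝ} (hc : 0 ≤ c) (hδ : c * δ < 1) {f : ℝ → A}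
    (hf : ExpGrowth c f) (M k : ℕ) :
    ∃ r : ℝ → ℝ, Tendsto r (𝓝 0) (𝓝 0) ∧ ∀ x : ℝ × ℝ, x.1 < 1 → |x.2| < δ →
      ‖flatLog (M + 1) k f x‖ ≤ r x.1 * |x.1| ^ M := by
  obtain ⟨C, hC0, hC⟩ := hf.exists_bound
  refine ⟨fun a => if 0 < a then C * (a ^ (1 - c * δ) * |Real.log a| ^ k) else 0, ?_, ?_⟩
  · have h1 : Tendsto (fun a : ℝ => C * (a ^ (1 - c * δ) * |Real.log a| ^ k)) (𝓝[>] 0) (𝓝 0) := by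
      simpa using (tendsto_rpow_mul_abs_log_pow (by linarith : 0 < 1 - c * δ) k).const_mul C
    rw [← nhdsLE_sup_nhdsGT (0 : ℝ), tendsto_sup, nhdsLE_sup_nhdsGT]
    refine ⟨?_, ?_⟩
    · refine (tendsto_const_nhds (x := (0 : ℝ))).congr' ?_
      filter_upwards [self_mem_nhdsWithin] with a ha
      rw [if_neg (not_lt.2 ha)]
    · refine h1.congr' ?_
      filter_upwards [self_mem_nhdsWithin] with a ha
      rw [if_pos (show 0 < a from ha)]
  · rintro ⟨a, α⟩ h1 h2
    simp only at h1 h2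
    by_cases ha : 0 < a
    · rw [flatLog_of_pos ha]
      simp only [if_pos ha, norm_smul, Real.norm_eq_abs, abs_mul, abs_pow, abs_of_pos ha]
      have hl : |Real.log a| = -Real.log a := abs_of_neg (Real.log_neg ha h1)
      have h3 : ‖f (α * Real.log a)‖ ≤ C * a ^ (-(c * δ)) := by
        refine (hC _).trans (mul_le_mul_of_nonneg_left ?_ hC0)
        rw [Real.rpow_def_of_pos ha, Real.exp_le_exp, abs_mul, hl]
        have : |α| * (-Real.log a) ≤ δ * (-Real.log a) :=
          mul_le_mul_of_nonneg_right h2.le (by rw [← hl]; exact abs_nonneg _)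
        nlinarith
      calc a ^ (M + 1) * |Real.log a| ^ k * ‖f (α * Real.log a)‖
          ≤ a ^ (M + 1) * |Real.log a| ^ k * (C * a ^ (-(c * δ))) := by gcongr
        _ = C * (a ^ (1 - c * δ) * |Real.log a| ^ k) * a ^ M := by
          rw [sub_eq_add_neg, Real.rpow_add ha, Real.rpow_one]; ring
    · rw [flatLog_of_nonpos (not_lt.1 ha)]
      simp [if_neg ha]

lemma continuousAt_flatLog {c δ : ℝ} (hc : 0 ≤ c) (hδ : c * δ < 1) {f : ℝ → A}
    (hf : ExpGrowth c f) (M k : ℕ) {x : ℝ × ℝ} (hx : |x.2| < δ) :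
    ContinuousAt (flatLog (M + 1) k f) x := by
  obtain ⟨a, α⟩ := x
  rcases lt_trichotomy a 0 with ha | rfl | ha
  · refine (continuousAt_const (y := (0 : A))).congr ?_
    filter_upwards [(isOpen_Iio.preimage continuous_fst).mem_nhds (show (a, α).1 ∈ Iio 0 from ha)]
      with y hy
    rw [flatLog_of_nonpos (le_of_lt hy)]
  · obtain ⟨r, hr, hb⟩ := exists_flatLog_bound hc hδ hf M k
    have h0 : flatLog (M + 1) k f ((0 : ℝ), α) = 0 := flatLog_of_nonpos le_rfl
    rw [ContinuousAt, h0]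
    refine squeeze_zero_norm' (a := fun y : ℝ × ℝ => r y.1 * |y.1| ^ M) ?_ ?_
    · have h1 : ∀ᶠ y : ℝ × ℝ in 𝓝 (0, α), y.1 < 1 :=
        (isOpen_Iio.preimage continuous_fst).mem_nhds (by simp)
      have h2 : ∀ᶠ y : ℝ × ℝ in 𝓝 (0, α), |y.2| < δ :=
        (isOpen_Iio.preimage (continuous_abs.comp continuous_snd)).mem_nhds hx
      filter_upwards [h1, h2] with y h1 h2 using hb y h1 h2
    · have h1 : Tendsto (fun y : ℝ × ℝ => r y.1) (𝓝 (0, α)) (𝓝 0) :=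
        hr.comp (continuous_fst.tendsto _)
      have h2 : Tendsto (fun y : ℝ × ℝ => |y.1| ^ M) (𝓝 (0, α)) (𝓝 (|(0 : ℝ)| ^ M)) :=
        ((continuous_abs.comp continuous_fst).pow M).tendsto _
      simpa using h1.mul h2
  · have h1 : ContinuousAt (fun y : ℝ × ℝ =>
        (y.1 ^ (M + 1) * Real.log y.1 ^ k) • f (y.2 * Real.log y.1)) (a, α) := by
      have hl : ContinuousAt (fun y : ℝ × ℝ => Real.log y.1) (a, α) :=
        continuousAt_fst.log ha.ne'
      exact ((continuousAt_fst.pow _).mul (hl.pow _)).smul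
        (hf.1.continuous.continuousAt.comp (continuousAt_snd.mul hl))
    refine h1.congr ?_
    filter_upwards [(isOpen_Ioi.preimage continuous_fst).mem_nhds (show (a, α).1 ∈ Ioi 0 from ha)]
      with y hy
    rw [flatLog_of_pos hy]

/-- The derivative of `flatLog (M + 1) k f`. -/
noncomputable def flatLogDeriv (M k : ℕ) (f : ℝ → A) (x : ℝ × ℝ) : ℝ × ℝ →L[ℝ] A :=
  (ContinuousLinearMap.fst ℝ ℝ ℝ).smulRight
      -- For k = 0 the truncated exponent k - 1 is harmless, since its coefficient is 0.
      (((M + 1 : ℕ) : ℝ) • flatLog M k f x + (k : ℝ) • flatLog M (k - 1) f x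
        + x.2 • flatLog M k (deriv f) x)
    + (ContinuousLinearMap.snd ℝ ℝ ℝ).smulRight (flatLog (M + 1) (k + 1) (deriv f) x)

/-- The a-derivative lowers the exponent of a by one; the α-derivative keeps it and adds a
logarithm. At a = 0 the bound r(a) |a|^(M+1) with r → 0 is o(|a|), so the derivative there is 0. -/
lemma hasFDerivAt_flatLog {c δ : ℝ} (hc : 0 ≤ c) (hδ : c * δ < 1) {f : ℝ → A}
    (hf : ExpGrowth c f) (M k : ℕ) {x : ℝ × ℝ} (hx : |x.2| < δ) :
    HasFDerivAt (flatLog (M + 2) k f) (flatLogDeriv (M + 1) k f x) x := by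
  obtain ⟨a, α⟩ := x
  rcases lt_trichotomy a 0 with ha | rfl | ha
  · have h0 : flatLogDeriv (M + 1) k f (a, α) = 0 := by
      simp [flatLogDeriv, flatLog, not_lt.2 ha.le]
    rw [h0]
    refine (hasFDerivAt_const (0 : A) _).congr_of_eventuallyEq ?_
    filter_upwards [(isOpen_Iio.preimage continuous_fst).mem_nhds (show (a, α).1 ∈ Iio 0 from ha)]
      with y hy
    rw [flatLog_of_nonpos (le_of_lt hy)]
  · have h0 : flatLogDeriv (M + 1) k f (0, α) = 0 := by
      simp [flatLogDeriv, flatLog]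
    rw [h0, hasFDerivAt_iff_isLittleO]
    simp only [flatLog_of_nonpos (M := M + 2) (k := k) (f := f) (x := ((0 : ℝ), α)) le_rfl,
      sub_zero, zero_apply]
    obtain ⟨r, hr, hb⟩ := exists_flatLog_bound hc hδ hf (M + 1) k
    have hr' : Tendsto (fun y : ℝ × ℝ => r y.1 * |y.1| ^ M) (𝓝 (0, α)) (𝓝 0) := by
      have h1 : Tendsto (fun y : ℝ × ℝ => r y.1) (𝓝 (0, α)) (𝓝 0) :=
        hr.comp (continuous_fst.tendsto _)
      have h2 : Tendsto (fun y : ℝ × ℝ => |y.1| ^ M) (𝓝 (0, α)) (𝓝 (|(0 : ℝ)| ^ M)) :=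
        ((continuous_abs.comp continuous_fst).pow M).tendsto _
      simpa using h1.mul h2
    rw [Asymptotics.isLittleO_iff]
    intro C hC
    have h1 : ∀ᶠ y : ℝ × ℝ in 𝓝 (0, α), y.1 < 1 :=
      (isOpen_Iio.preimage continuous_fst).mem_nhds (by simp)
    have h2 : ∀ᶠ y : ℝ × ℝ in 𝓝 (0, α), |y.2| < δ :=
      (isOpen_Iio.preimage (continuous_abs.comp continuous_snd)).mem_nhds hx
    filter_upwards [h1, h2, hr'.eventually_le_const hC] with y h1 h2 h3
    refine (hb y h1 h2).trans ?_
    rw [pow_succ, ← mul_assoc]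
    refine mul_le_mul h3 ?_ (abs_nonneg _) hC.le
    have := norm_fst_le (y - (0, α))
    simpa using this
  · have hfst : HasFDerivAt (fun y : ℝ × ℝ => y.1) (ContinuousLinearMap.fst ℝ ℝ ℝ) (a, α) :=
      hasFDerivAt_fst
    have hsnd : HasFDerivAt (fun y : ℝ × ℝ => y.2) (ContinuousLinearMap.snd ℝ ℝ ℝ) (a, α) :=
      hasFDerivAt_snd
    have hl : HasFDerivAt (fun y : ℝ × ℝ => Real.log y.1) _ (a, α) := hfst.log ha.ne'
    have h1 := ((hfst.pow (M + 2)).mul (hl.pow k)).smul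
      ((hf.hasDerivAt (α * Real.log a)).hasFDerivAt.comp (a, α) (hsnd.mul hl))
    have h2 : HasFDerivAt (flatLog (M + 2) k f) _ (a, α) := h1.congr_of_eventuallyEq (by
      filter_upwards [(isOpen_Ioi.preimage continuous_fst).mem_nhds
        (show (a, α).1 ∈ Ioi 0 from ha)] with y hy
      rw [flatLog_of_pos hy]; rfl)
    refine h2.congr_fderiv ?_
    have e1 : ∀ (N j : ℕ) (g : ℝ → A), flatLog N j g (a, α)
        = (a ^ N * Real.log a ^ j) • g (α * Real.log a) := fun N j g => flatLog_of_pos ha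
    apply ContinuousLinearMap.ext
    rintro ⟨s, t⟩
    simp [flatLogDeriv, e1, smul_smul, ← add_smul]
    match_scalars <;> field_simp <;> ring

/-- The derivative is built from functions of the same kind with the exponent lowered by at most
one. The induction therefore runs over all profiles f and all k at once, and the last power of a
gives continuity. -/
lemma contDiffAt_flatLog {c δ : ℝ} (hc : 0 ≤ c) (hδ : c * δ < 1) (n : ℕ) :
    ∀ {f : ℝ → A}, ExpGrowth c f → ∀ {M : ℕ} (k : ℕ), n + 1 ≤ M → ∀ {x : ℝ × ℝ}, |x.2| < δ →
      ContDiffAt ℝ n (flatLog M k f) x := by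
  induction n with
  | zero =>
    intro f hf M k hM x hx
    obtain ⟨M, rfl⟩ := Nat.exists_eq_add_of_le' hM
    rw [Nat.cast_zero, contDiffAt_zero]
    refine ⟨{y | |y.2| < δ},
      (isOpen_Iio.preimage (continuous_abs.comp continuous_snd)).mem_nhds hx, fun y hy => ?_⟩
    exact (continuousAt_flatLog hc hδ hf M k hy).continuousWithinAt
  | succ n ih =>
    intro f hf M k hM x hx
    obtain ⟨M, rfl⟩ := Nat.exists_eq_add_of_le' (show 2 ≤ M by omega)
    rw [Nat.cast_succ, contDiffAt_succ_iff_hasFDerivAt]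
    refine ⟨flatLogDeriv (M + 1) k f, ⟨{y | |y.2| < δ},
      (isOpen_Iio.preimage (continuous_abs.comp continuous_snd)).mem_nhds hx,
      fun y hy => hasFDerivAt_flatLog hc hδ hf M k hy⟩, ?_⟩
    have h1 := ih hf (M := M + 1) k (by omega) hx
    have h2 := ih hf (M := M + 1) (k - 1) (by omega) hx
    have h3 := ih hf.deriv (M := M + 1) k (by omega) hx
    have h4 := ih hf.deriv (M := M + 2) (k + 1) (by omega) hx
    have h5 : ContDiffAt ℝ n (fun y : ℝ × ℝ => y.2) x := contDiffAt_snd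
    have e1 : ContDiffAt ℝ n (fun y => ((M + 1 + 1 : ℕ) : ℝ) • flatLog (M + 1) k f y
        + (k : ℝ) • flatLog (M + 1) (k - 1) f y + y.2 • flatLog (M + 1) k (deriv f) y) x :=
      ((contDiffAt_const.smul h1).add (contDiffAt_const.smul h2)).add (h5.smul h3)
    exact (contDiffAt_const.smulRight e1).add (contDiffAt_const.smulRight h4)

end FlatFunctions

/-! ### Stability of exponential growth under products and linear maps -/

section ExpGrowthAlgebra

variable {A : Type*} [NormedCommRing A] [NormedAlgebra ℝ A]

lemma ExpGrowth.mul {c d : ℝ} {f g : ℝ → A} (hf : ExpGrowth c f) (hg : ExpGrowth d g) :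
    ExpGrowth (c + d) (fun x => f x * g x) := by
  refine ⟨hf.1.mul hg.1, fun k => ?_⟩
  choose C hC using hf.2
  choose D hD using hg.2
  refine ⟨∑ i ∈ Finset.range (k + 1), (k.choose i : ℝ) * C i * D (k - i), fun x => ?_⟩
  rw [← norm_iteratedFDeriv_eq_norm_iteratedDeriv, Finset.sum_mul]
  refine (norm_iteratedFDeriv_mul_le hf.1 hg.1 x (n := k) (by exact_mod_cast le_top)).trans ?_
  refine Finset.sum_le_sum fun i _ => ?_
  rw [norm_iteratedFDeriv_eq_norm_iteratedDeriv, norm_iteratedFDeriv_eq_norm_iteratedDeriv,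
    add_mul, Real.exp_add]
  have h1 := mul_le_mul (hC i x) (hD (k - i) x) (norm_nonneg _) ((norm_nonneg _).trans (hC i x))
  have h2 := mul_le_mul_of_nonneg_left h1 (Nat.cast_nonneg (α := ℝ) (k.choose i))
  nlinarith [h2]

lemma expGrowth_const (a : A) : ExpGrowth 0 (fun _ : ℝ => a) := by
  refine ⟨contDiff_const, fun k => ⟨‖a‖, fun x => ?_⟩⟩
  simp only [iteratedDeriv_const, zero_mul, Real.exp_zero, mul_one]
  split_ifs <;> simp

lemma ExpGrowth.pow {c : ℝ} {f : ℝ → A} (hf : ExpGrowth c f) (n : ℕ) :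
    ExpGrowth (n * c) (fun x => f x ^ n) := by
  induction n with
  | zero => simpa using expGrowth_const (1 : A)
  | succ n ih =>
    have := ih.mul hf
    simp only [← pow_succ] at this
    convert this using 1
    push_cast; ring

lemma ExpGrowth.clm {B : Type*} [NormedAddCommGroup B] [NormedSpace ℝ B] {c : ℝ} {f : ℝ → A}
    (hf : ExpGrowth c f) (V : A →L[ℝ] B) : ExpGrowth c (fun x => V (f x)) := by
  refine ⟨V.contDiff.comp hf.1, fun k => ?_⟩
  obtain ⟨C, hC⟩ := hf.2 k
  refine ⟨‖V‖ * C, fun x => ?_⟩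
  rw [← norm_iteratedFDeriv_eq_norm_iteratedDeriv]
  refine (V.norm_iteratedFDeriv_comp_left (hf.1.contDiffAt (x := x)) (n := k)
    (by exact_mod_cast le_top)).trans ?_
  rw [norm_iteratedFDeriv_eq_norm_iteratedDeriv, mul_assoc]
  exact mul_le_mul_of_nonneg_left (hC x) (norm_nonneg _)

end ExpGrowthAlgebra

/-! ### The integral operator and exponentials in C([0,1]) -/

section Volterra

/-- Continuous functions on the unit interval. -/
abbrev UnitFun : Type := C(unitInterval, ℝ)

/-- The continuous extension of a function on the unit interval to the line. -/
noncomputable def UnitFun.extend (f : UnitFun) : ℝ → ℝ := IccExtend zero_le_one f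

lemma UnitFun.continuous_extend (f : UnitFun) : Continuous f.extend :=
  f.continuous.Icc_extend'

lemma UnitFun.extend_coe (f : UnitFun) (s : unitInterval) : f.extend s = f s :=
  IccExtend_val _ _ _

lemma UnitFun.abs_extend_le (f : UnitFun) (s : ℝ) : |f.extend s| ≤ ‖f‖ :=
  f.norm_coe_le_norm _

lemma UnitFun.hasDerivAt_integral (f : UnitFun) (s : ℝ) :
    HasDerivAt (fun t => ∫ τ in (0 : ℝ)..t, f.extend τ) (f.extend s) s :=
  intervalIntegral.integral_hasDerivAt_right (f.continuous_extend.intervalIntegrable _ _)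
    f.continuous_extend.stronglyMeasurable.stronglyMeasurableAtFilter
    f.continuous_extend.continuousAt

/-- The integral from `0`, as an operator on the continuous functions on the unit interval. -/
noncomputable def volterra : UnitFun →L[ℝ] UnitFun :=
  LinearMap.mkContinuous
    { toFun := fun f => ⟨fun s => ∫ τ in (0 : ℝ)..s, f.extend τ,
        (continuous_iff_continuousAt.2 fun s => (f.hasDerivAt_integral s).continuousAt).comp
          continuous_subtype_val⟩
      map_add' := fun f g => by
        ext s
        exact intervalIntegral.integral_add (f.continuous_extend.intervalIntegrable _ _)
          (g.continuous_extend.intervalIntegrable _ _)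
      map_smul' := fun c f => by
        ext s
        exact intervalIntegral.integral_const_mul c _ } 1 (fun f => by
      rw [one_mul, ContinuousMap.norm_le _ (norm_nonneg _)]
      intro s
      have h := intervalIntegral.norm_integral_le_of_norm_le_const (a := (0 : ℝ)) (b := (s : ℝ))
        (f := f.extend) (C := ‖f‖) (fun x _ => f.abs_extend_le x)
      refine h.trans ?_
      rw [sub_zero, abs_of_nonneg s.2.1]
      exact mul_le_of_le_one_right (norm_nonneg _) s.2.2)

lemma volterra_apply (f : UnitFun) (s : unitInterval) :
    volterra f s = ∫ τ in (0 : ℝ)..s, f.extend τ := rfl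

/-- The function `s ↦ exp (x s)` on the unit interval. -/
noncomputable def expFun (x : ℝ) : UnitFun := ⟨fun s => Real.exp (x * s), by fun_prop⟩

lemma expFun_apply (x : ℝ) (s : unitInterval) : expFun x s = Real.exp (x * s) := rfl

/-- Makes the calculus of the exponential in the Banach algebra C([0,1]) available. -/
lemma expFun_eq_exp (x : ℝ) :
    expFun x = NormedSpace.exp (x • (⟨fun s => (s : ℝ), by fun_prop⟩ : UnitFun)) := by
  ext s
  have h := NormedSpace.map_exp (ContinuousMap.evalAlgHom ℝ ℝ s)
    (continuous_eval_const s) (x • (⟨fun s => (s : ℝ), by fun_prop⟩ : UnitFun))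
  have h2 : NormedSpace.exp (x • (⟨fun s => (s : ℝ), by fun_prop⟩ : UnitFun)) s
      = NormedSpace.exp (x * (s : ℝ)) := h
  rw [h2, ← Real.exp_eq_exp_ℝ, expFun_apply]

lemma norm_expFun_le (x : ℝ) : ‖expFun x‖ ≤ Real.exp |x| := by
  rw [ContinuousMap.norm_le _ (Real.exp_pos _).le]
  intro s
  rw [expFun_apply, Real.norm_eq_abs, Real.abs_exp, Real.exp_le_exp]
  refine (le_abs_self _).trans ?_
  rw [abs_mul, abs_of_nonneg s.2.1]
  exact mul_le_of_le_one_right (abs_nonneg _) s.2.2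

/-- With g(s) = bs the k-th derivative is exp(xg) g^k, so the function itself controls all its
derivatives; its sup norm over s ∈ [0,1] is at most e^|bx|. -/
lemma expGrowth_expFun (b : ℝ) : ExpGrowth |b| (fun x => expFun (b * x)) := by
  set g : UnitFun := b • ⟨fun s => (s : ℝ), by fun_prop⟩ with hg
  have he : (fun x => expFun (b * x)) = fun x : ℝ => NormedSpace.exp (x • g) := by
    funext x
    rw [expFun_eq_exp, hg, smul_smul, mul_comm]
  have hd : ∀ x : ℝ, HasDerivAt (fun x : ℝ => NormedSpace.exp (x • g))
      (NormedSpace.exp (x • g) * g) x := fun x => hasDerivAt_exp_smul_const g x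
  have hk : ∀ k, iteratedDeriv k (fun x : ℝ => NormedSpace.exp (x • g))
      = fun x : ℝ => NormedSpace.exp (x • g) * g ^ k := by
    intro k
    induction k with
    | zero => funext x; simp
    | succ k ih =>
      rw [iteratedDeriv_succ, ih]
      funext x
      rw [((hd x).mul_const (g ^ k)).deriv, pow_succ']
      ring
  refine ⟨?_, fun k => ⟨‖g ^ k‖, fun x => ?_⟩⟩
  · rw [he]
    refine contDiff_infty.2 fun n => contDiff_of_differentiable_iteratedDeriv fun k _ => ?_
    rw [hk]
    exact fun x => ((hd x).mul_const (g ^ k)).differentiableAt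
  · have hx : expFun (b * x) = NormedSpace.exp (x • g) := congrFun he x
    simp only [he, hk]
    rw [← hx, mul_comm ‖g ^ k‖, ← abs_mul]
    exact (norm_mul_le _ _).trans (mul_le_mul_of_nonneg_right (norm_expFun_le _) (norm_nonneg _))

end Volterra

/-! ### Trajectories: uniqueness and first hitting of the section -/

section Trajectories

/-- The field is only locally Lipschitz, but the two arcs are compact and lie in one closed ball,
where a C^1 field is Lipschitz. -/
lemma IsIntegralCurveOn.eqOn_of_contDiff {E : Type*} [NormedAddCommGroup E] [NormedSpace ℝ E]
    [FiniteDimensional ℝ E] {X : E → E} (hX : ContDiff ℝ 1 X) {γ₁ γ₂ : ℝ → E} {T : ℝ}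
    (h₁ : IsIntegralCurveOn γ₁ (fun _ => X) (Icc 0 T))
    (h₂ : IsIntegralCurveOn γ₂ (fun _ => X) (Icc 0 T)) (h : γ₁ 0 = γ₂ 0) :
    EqOn γ₁ γ₂ (Icc 0 T) := by
  have : ProperSpace E := FiniteDimensional.proper ℝ E
  have hc₁ : ContinuousOn γ₁ (Icc 0 T) := h₁.continuousOn
  have hc₂ : ContinuousOn γ₂ (Icc 0 T) := h₂.continuousOn
  obtain ⟨r, hr⟩ := ((isCompact_Icc.image_of_continuousOn hc₁).union
    (isCompact_Icc.image_of_continuousOn hc₂)).isBounded.subset_closedBall 0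
  obtain ⟨K, hK⟩ := hX.contDiffOn (s := Metric.closedBall (0 : E) r)
    |>.exists_lipschitzOnWith (by simp) (convex_closedBall 0 r) (isCompact_closedBall 0 r)
  have key : ∀ {γ : ℝ → E}, IsIntegralCurveOn γ (fun _ => X) (Icc 0 T) →
      ∀ t ∈ Ico 0 T, HasDerivWithinAt γ (X (γ t)) (Ici t) t := fun hγ t ht =>
    ((hγ t (Ico_subset_Icc_self ht)).mono (Icc_subset_Icc_left ht.1)).mono_of_mem_nhdsWithin
      (Icc_mem_nhdsGE ht.2)
  exact ODE_solution_unique_of_mem_Icc_right (v := fun _ => X)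
    (s := fun _ => Metric.closedBall (0 : E) r) (K := K) (fun _ _ => hK) hc₁ (key h₁)
    (fun t ht => hr (Or.inl ⟨t, Ico_subset_Icc_self ht, rfl⟩)) hc₂ (key h₂)
    (fun t ht => hr (Or.inr ⟨t, Ico_subset_Icc_self ht, rfl⟩)) h

/-- `y` is the third component of a trajectory starting at `(u, v, y 0)`, on `[0, T]`. -/
def IsFiberSolution (X : ℝ × ℝ × ℝ → ℝ × ℝ × ℝ) (u v T : ℝ) (y : ℝ → ℝ) : Prop :=
  ∀ t ∈ Icc 0 T, HasDerivWithinAt y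
    (X (u * Real.exp t, v * Real.exp (-t), y t)).2.2 (Icc 0 T) t

lemma IsFiberSolution.isIntegralCurveOn {X : ℝ × ℝ × ℝ → ℝ × ℝ × ℝ}
    (h1 : ∀ x, (X x).1 = x.1) (h2 : ∀ x, (X x).2.1 = -x.2.1) {u v T : ℝ} {y : ℝ → ℝ}
    (hy : IsFiberSolution X u v T y) :
    IsIntegralCurveOn (fun t => (u * Real.exp t, v * Real.exp (-t), y t)) (fun _ => X)
      (Icc 0 T) := by
  intro t ht
  have e : X (u * Real.exp t, v * Real.exp (-t), y t) = (u * Real.exp t, -(v * Real.exp (-t)),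
      (X (u * Real.exp t, v * Real.exp (-t), y t)).2.2) := by
    ext <;> simp [h1, h2]
  simp only
  rw [e]
  refine HasDerivWithinAt.prodMk ?_ (HasDerivWithinAt.prodMk ?_ (hy t ht))
  · exact ((Real.hasDerivAt_exp t).const_mul u).hasDerivWithinAt
  · have := ((hasDerivAt_neg t).exp).const_mul v
    exact (this.congr_deriv (by ring)).hasDerivWithinAt

lemma IsFiberSolution.unique {X : ℝ × ℝ × ℝ → ℝ × ℝ × ℝ} (hX : ContDiff ℝ 1 X)
    (h1 : ∀ x, (X x).1 = x.1) (h2 : ∀ x, (X x).2.1 = -x.2.1) {u v T : ℝ} {y z : ℝ → ℝ}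
    (hy : IsFiberSolution X u v T y) (hz : IsFiberSolution X u v T z) (h : y 0 = z 0) :
    EqOn y z (Icc 0 T) := by
  intro t ht
  have := (hy.isIntegralCurveOn h1 h2).eqOn_of_contDiff hX (hz.isIntegralCurveOn h1 h2)
    (by simp [h]) ht
  simpa using this

/-- The u-component increases strictly, so it equals u₀ only at time log(u₀/u), and the bounds on v
and Y put that point on the section. Any other trajectory from the same point agrees with this one
up to the shorter of the two times, which forces the same first hitting point. -/
lemma IsFiberSolution.hasTransition {X : ℝ × ℝ × ℝ → ℝ × ℝ × ℝ} (hX : ContDiff ℝ 1 X)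
    (h1 : ∀ x, (X x).1 = x.1) (h2 : ∀ x, (X x).2.1 = -x.2.1) {u₀ v₀ Y₀ u v : ℝ} {y : ℝ → ℝ}
    (hu : 0 < u) (huu : u < u₀) (hv : 0 ≤ v) (hvv : v ≤ v₀)
    (hy : IsFiberSolution X u v (Real.log (u₀ / u)) y) (hYt : |y (Real.log (u₀ / u))| ≤ Y₀) :
    HasTransition X u₀ v₀ Y₀ u v (y 0) (y (Real.log (u₀ / u))) := by
  have hu₀ : 0 < u₀ := hu.trans huu
  set T := Real.log (u₀ / u) with hT
  have hT0 : 0 < T := Real.log_pos (by rwa [one_lt_div hu])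
  have heT : Real.exp T = u₀ / u := Real.exp_log (by positivity)
  set γ : ℝ → ℝ × ℝ × ℝ := fun t => (u * Real.exp t, v * Real.exp (-t), y t) with hγdef
  have hγ : IsIntegralCurveOn γ (fun _ => X) (Icc 0 T) := hy.isIntegralCurveOn h1 h2
  have hγ0 : γ 0 = (u, v, y 0) := by simp [hγdef]
  have hγT : γ T = (u₀, u * v / u₀, y T) := by
    simp only [hγdef, Real.exp_neg, heT]
    refine Prod.ext ?_ (Prod.ext ?_ rfl) <;> simp only <;> field_simp
  have hS : γ T ∈ outSection u₀ v₀ Y₀ := by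
    rw [hγT]
    refine ⟨rfl, ⟨by positivity, ?_⟩, abs_le.1 hYt⟩
    refine le_trans ?_ hvv
    rw [div_le_iff₀ hu₀, mul_comm]
    exact mul_le_mul_of_nonneg_left huu.le hv
  have hnS : ∀ t ∈ Ico 0 T, γ t ∉ outSection u₀ v₀ Y₀ := by
    rintro t ⟨-, ht⟩ ⟨h, -⟩
    have h3 : u * Real.exp t < u * Real.exp T :=
      mul_lt_mul_of_pos_left (Real.exp_lt_exp.2 ht) hu
    rw [heT, mul_div_cancel₀ _ hu.ne'] at h3
    exact h3.ne h
  intro z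
  constructor
  · rintro ⟨T', hT', γ', hγ', hγ'0, rfl, hz, hz'⟩
    rw [← hγT]
    have h0 : γ 0 = γ' 0 := by rw [hγ0, hγ'0]
    rcases lt_trichotomy T' T with h | h | h
    · have e := (hγ.mono (Icc_subset_Icc_right h.le)).eqOn_of_contDiff hX hγ' h0
        (right_mem_Icc.2 hT'.le)
      exact absurd (e ▸ hz) (hnS T' ⟨hT'.le, h⟩)
    · subst h
      exact (hγ.eqOn_of_contDiff hX hγ' h0 (right_mem_Icc.2 hT'.le)).symm
    · have e := hγ.eqOn_of_contDiff hX (hγ'.mono (Icc_subset_Icc_right h.le)) h0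
        (right_mem_Icc.2 hT0.le)
      exact absurd (e ▸ hS) (hz' T ⟨hT0.le, h⟩)
  · rintro rfl
    exact ⟨T, hT0, γ, hγ, hγ0, hγT, hγT ▸ hS, hnS⟩

variable {m : ℕ}

lemma contDiff_resonantField (p q : ℕ) (φ : Param m → ℝ[X]) (Φ : Param m → MvPolynomial (Fin 2) ℝ)
    (η : Param m → ℝ[X]) (P : Param m) : ContDiff ℝ 1 (resonantField p q φ Φ η P) := by
  have h1 : ∀ f : ℝ[X], ContDiff ℝ 1 (fun x : ℝ × ℝ × ℝ => f.eval (x.1 * x.2.1)) := fun f =>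
    (f.contDiff_aeval 1).comp (by fun_prop)
  have h2 : ContDiff ℝ 1 (fun x : ℝ × ℝ × ℝ =>
      MvPolynomial.eval ![x.1 * x.2.1, x.1 ^ p * x.2.2 ^ q] (Φ P)) := by
    simp only [MvPolynomial.eval_eq', Fin.prod_univ_two]
    refine ContDiff.sum fun i _ => ?_
    simp only [Matrix.cons_val_zero, Matrix.cons_val_one]
    fun_prop
  have h3 := h1 (φ P)
  have h4 := h1 (η P)
  unfold resonantField sigmaBar
  fun_prop

lemma nonresonantField_eq (φ : Param m → ℝ[X]) (P : Param m) :
    nonresonantField φ P = resonantField 1 1 φ 0 0 P := by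
  funext x
  simp [nonresonantField, resonantField]

end Trajectories

/-! ### The integral equation for the remainder -/

section IntegralEquation

/-- The coefficient of `ν ^ i * s ^ (j + 1)` in a polynomial in `(ν, s)`. -/
noncomputable def coeffSucc (f : MvPolynomial (Fin 2) ℝ) (i j : ℕ) : ℝ :=
  f.coeff (Finsupp.single 0 i + Finsupp.single 1 (j + 1))

lemma eval_eq_sum_range_range {K : ℕ} {f : MvPolynomial (Fin 2) ℝ} (hK : f.totalDegree ≤ K)
    (x y : ℝ) : MvPolynomial.eval ![x, y] f = ∑ i ∈ Finset.range (K + 1),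
      ∑ j ∈ Finset.range (K + 1),
        f.coeff (Finsupp.single 0 i + Finsupp.single 1 j) * x ^ i * y ^ j := by
  set F : ℕ × ℕ → Fin 2 →₀ ℕ := fun z => Finsupp.single 0 z.1 + Finsupp.single 1 z.2 with hF
  have hF0 : ∀ z, F z 0 = z.1 := fun z => by simp [hF]
  have hF1 : ∀ z, F z 1 = z.2 := fun z => by simp [hF]
  have hinj : Function.Injective F := fun z w h => by
    ext
    · rw [← hF0, h, hF0]
    · rw [← hF1, h, hF1]
  have hsub : f.support ⊆ (Finset.range (K + 1) ×ˢ Finset.range (K + 1)).image F := by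
    intro d hd
    have hdeg := (MvPolynomial.le_totalDegree hd).trans hK
    rw [Finsupp.sum_fintype _ _ (by simp), Fin.sum_univ_two] at hdeg
    refine Finset.mem_image.2 ⟨(d 0, d 1), ?_, ?_⟩
    · simp only [Finset.mem_product, Finset.mem_range]; omega
    · ext i
      fin_cases i
      · exact hF0 _
      · exact hF1 _
  rw [MvPolynomial.eval_eq', Finset.sum_subset hsub
    (fun d _ hd => by rw [MvPolynomial.notMem_support_iff.1 hd, zero_mul]),
    Finset.sum_image hinj.injOn, Finset.sum_product]
  refine Finset.sum_congr rfl fun i _ => Finset.sum_congr rfl fun j _ => ?_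
  rw [Fin.prod_univ_two, hF0, hF1]
  simp only [Matrix.cons_val_zero, Matrix.cons_val_one, mul_assoc]
  rfl

/-- Vanishing on y = 0 removes the terms without y. The surviving factor y^(j+1) later supplies the
power of u that makes the equation flat. -/
lemma eval_eq_sum_coeffSucc {K : ℕ} {f : MvPolynomial (Fin 2) ℝ} (hK : f.totalDegree ≤ K)
    (h0 : ∀ x : ℝ, MvPolynomial.eval ![x, 0] f = 0) (x y : ℝ) :
    MvPolynomial.eval ![x, y] f = ∑ i ∈ Finset.range (K + 1), ∑ j ∈ Finset.range K,
      coeffSucc f i j * x ^ i * y ^ (j + 1) := by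
  have h1 := h0 x
  rw [eval_eq_sum_range_range hK] at h1 ⊢
  rw [Finset.sum_congr rfl fun i _ => Finset.sum_range_succ' _ K, Finset.sum_add_distrib] at h1 ⊢
  have h2 : ∑ i ∈ Finset.range (K + 1), f.coeff (Finsupp.single 0 i + Finsupp.single 1 0)
      * x ^ i * y ^ 0 = 0 := by
    simpa using h1
  rw [h2, add_zero]
  rfl

/-- The compensator along a trajectory in rescaled time: `s ↦ ∫ τ in 0..sT, exp (α τ)`. -/
noncomputable def compFun (T α : ℝ) : UnitFun := T • volterra (expFun (α * T))

/-- The right-hand side of the integral equation for the remainder, in rescaled time. -/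
noncomputable def remainderField (q K : ℕ) (c : ℕ → ℕ → ℝ) (T α ν U κ Y : ℝ) (R : UnitFun) :
    UnitFun :=
  ∑ i ∈ Finset.range (K + 1), ∑ j ∈ Finset.range K,
    (c i j * ν ^ i * (T * U ^ (j + 1))) • (expFun (-(q * (j + 1) : ℕ) * α * T)
      * (Y • (1 : UnitFun) + κ • compFun T α + R) ^ (q * (j + 1) + 1))

/-- The expanded definition suits the regularity argument; this factored form suits the differential
equation and the estimates. -/
lemma remainderField_apply (q K : ℕ) (c : ℕ → ℕ → ℝ) (T α ν U κ Y : ℝ) (R : UnitFun)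
    (s : unitInterval) :
    remainderField q K c T α ν U κ Y R s = T * (∑ i ∈ Finset.range (K + 1),
      ∑ j ∈ Finset.range K, c i j * ν ^ i
        * (U * Real.exp (-(q * α * (T * s))) * (Y + κ * compFun T α s + R s) ^ q) ^ (j + 1))
      * (Y + κ * compFun T α s + R s) := by
  simp only [remainderField, ContinuousMap.coe_sum, Finset.sum_apply, Finset.mul_sum,
    Finset.sum_mul]
  refine Finset.sum_congr rfl fun i _ => Finset.sum_congr rfl fun j _ => ?_
  simp only [ContinuousMap.smul_apply, ContinuousMap.mul_apply, ContinuousMap.pow_apply,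
    ContinuousMap.add_apply, ContinuousMap.one_apply, smul_eq_mul, expFun_apply, mul_one]
  have e : Real.exp (-((q * (j + 1) : ℕ) : ℝ) * α * T * s)
      = Real.exp (-(q * α * (T * s))) ^ (j + 1) := by
    rw [← Real.exp_nat_mul]; congr 1; push_cast; ring
  rw [e]
  ring

lemma hasDerivWithinAt_extend_volterra (f : UnitFun) {s : ℝ} (hs : s ∈ Icc (0 : ℝ) 1) :
    HasDerivWithinAt (volterra f).extend (f.extend s) (Icc 0 1) s := by
  refine (f.hasDerivAt_integral s).hasDerivWithinAt.congr_of_mem (fun t ht => ?_) hs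
  exact (volterra f).extend_coe ⟨t, ht⟩

variable {m : ℕ}

/-- The integral equation for the remainder of the transition map. -/
def IsRemainder (p q K : ℕ) (σ₀ u₀ : ℝ) (φ : Param m → ℝ[X]) (Φ : Param m → MvPolynomial (Fin 2) ℝ)
    (η : Param m → ℝ[X]) (P : Param m) (Y u v : ℝ) (R : UnitFun) : Prop :=
  R = volterra (remainderField q K (coeffSucc (Φ P)) (Real.log (u₀ / u)) (alpha σ₀ φ P (u * v))
    (u * v) (u ^ p) (v ^ p * (η P).eval (u * v)) Y R)

/-- The fiber component of the trajectory belonging to a solution of the integral equation. -/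
noncomputable def fiberCurve (σ T α κ Y : ℝ) (R : UnitFun) (t : ℝ) : ℝ :=
  Real.exp (-(σ * t)) * (Y + κ * (compFun T α).extend (t / T) + R.extend (t / T))

/-- Variation of constants, based on two identities: qσ̄ = p + qα turns u(t)^p Y(t)^q into u^p
e^(-qαt) Z^q, and for q = 1 the same relation gives e^(-pt) = e^(-σ̄t) e^(αt), which turns the
η-term into the derivative of the compensator. For q ≠ 1 there is no η-term. -/
lemma IsRemainder.isFiberSolution {p q K : ℕ} {σ₀ u₀ : ℝ} {L : Set (Param m)}
    {φ : Param m → ℝ[X]} {Φ : Param m → MvPolynomial (Fin 2) ℝ} {η : Param m → ℝ[X]}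
    (hq : 0 < q) (hσ₀ : σ₀ = (p : ℝ) / q) (h : IsResonantFamily q L K φ Φ η) {P : Param m}
    (hP : P ∈ L) {Y u v : ℝ} (hu : 0 < u) (huu : u < u₀) {R : UnitFun}
    (hR : IsRemainder p q K σ₀ u₀ φ Φ η P Y u v R) :
    IsFiberSolution (resonantField p q φ Φ η P) u v (Real.log (u₀ / u))
      (fiberCurve (sigmaBar φ P (u * v)) (Real.log (u₀ / u)) (alpha σ₀ φ P (u * v))
        (v ^ p * (η P).eval (u * v)) Y R) := by
  set T := Real.log (u₀ / u) with hT
  set ν := u * v with hν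
  set α := alpha σ₀ φ P ν with hα
  set κ := v ^ p * (η P).eval ν with hκ
  set S := sigmaBar φ P ν with hS
  have hT0 : 0 < T := Real.log_pos (by rwa [one_lt_div hu])
  have hq0 : (q : ℝ) ≠ 0 := by exact_mod_cast hq.ne'
  intro t ht
  have hs : t / T ∈ Icc (0 : ℝ) 1 := ⟨div_nonneg ht.1 hT0.le, (div_le_one hT0).2 ht.2⟩
  have hmaps : MapsTo (fun t => t / T) (Icc 0 T) (Icc 0 1) := fun t ht =>
    ⟨div_nonneg ht.1 hT0.le, (div_le_one hT0).2 ht.2⟩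
  set G := remainderField q K (coeffSucc (Φ P)) T α ν (u ^ p) κ Y R with hG
  have hRG : R = volterra G := hR
  have d0 : HasDerivWithinAt (fun t : ℝ => t / T) (1 / T) (Icc 0 T) t :=
    ((hasDerivAt_id t).div_const T).hasDerivWithinAt
  have d1 : HasDerivWithinAt (fun t => R.extend (t / T)) (G.extend (t / T) * (1 / T)) (Icc 0 T) t := by
    have := (hasDerivWithinAt_extend_volterra G hs).comp t d0 hmaps
    rw [← hRG] at this
    exact this
  have d2 : HasDerivWithinAt (fun t => (compFun T α).extend (t / T)) (Real.exp (α * t)) (Icc 0 T) t := by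
    have e : ∀ s ∈ Icc (0 : ℝ) 1, (compFun T α).extend s
        = T * (volterra (expFun (α * T))).extend s := fun s hs => by
      have h1 := (compFun T α).extend_coe ⟨s, hs⟩
      have h2 := (volterra (expFun (α * T))).extend_coe ⟨s, hs⟩
      simp only at h1 h2
      rw [h1, h2]; rfl
    have h3 := (((hasDerivWithinAt_extend_volterra (expFun (α * T)) hs).const_mul T).congr_of_mem
      e hs).comp t d0 hmaps
    refine h3.congr_deriv ?_
    have h4 := (expFun (α * T)).extend_coe ⟨t / T, hs⟩
    simp only [expFun_apply] at h4
    rw [h4]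
    have : α * T * (t / T) = α * t := by field_simp
    rw [this]; field_simp
  have d3 : HasDerivWithinAt (fun t => Real.exp (-(S * t))) (Real.exp (-(S * t)) * -(S * 1))
      (Icc 0 T) t :=
    (((hasDerivAt_id t).const_mul S).neg.exp).hasDerivWithinAt
  have d4 := d3.mul (((d2.const_mul κ).const_add Y).add d1)
  refine d4.congr_deriv ?_
  have hG2 : G.extend (t / T) * (1 / T) = MvPolynomial.eval ![ν, u ^ p * Real.exp (-(q * α * t))
      * (Y + κ * (compFun T α).extend (t / T) + R.extend (t / T)) ^ q] (Φ P)
      * (Y + κ * (compFun T α).extend (t / T) + R.extend (t / T)) := by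
    have h1 := G.extend_coe ⟨t / T, hs⟩
    have h2 := (compFun T α).extend_coe ⟨t / T, hs⟩
    have h3 := R.extend_coe ⟨t / T, hs⟩
    simp only at h1 h2 h3
    rw [h1, h2, h3, hG, remainderField_apply, eval_eq_sum_coeffSucc (h.smooth_Phi.1 P hP)
      (h.Phi_zero P hP)]
    simp only [mul_div_cancel₀ t hT0.ne']
    field_simp
  rw [hG2]
  have hν2 : u * Real.exp t * (v * Real.exp (-t)) = ν := by
    rw [hν, Real.exp_neg]; field_simp
  simp only [resonantField, hν2, fiberCurve, Pi.add_apply]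
  set Z := Y + κ * (compFun T α).extend (t / T) + R.extend (t / T) with hZ
  have hσq : (q : ℝ) * S = p + q * α := by
    rw [hα, alpha, ← hS, hσ₀]; field_simp; ring
  have e1 : (u * Real.exp t) ^ p * (Real.exp (-(S * t)) * Z) ^ q
      = u ^ p * Real.exp (-(q * α * t)) * Z ^ q := by
    rw [mul_pow, mul_pow, ← Real.exp_nat_mul, ← Real.exp_nat_mul]
    have : Real.exp (-(q * α * t)) = Real.exp (p * t) * Real.exp (q * -(S * t)) := by
      rw [← Real.exp_add]; congr 1; linear_combination t * hσq
    rw [this]; ring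
  have e2 : (v * Real.exp (-t)) ^ p * (η P).eval ν = Real.exp (-(S * t)) * (κ * Real.exp (α * t)) := by
    by_cases hq1 : q = 1
    · subst hq1
      have : Real.exp (-(S * t)) * Real.exp (α * t) = Real.exp (p * -t) := by
        rw [← Real.exp_add]; congr 1
        simp only [Nat.cast_one, one_mul] at hσq
        linear_combination (-t) * hσq
      rw [mul_pow, ← Real.exp_nat_mul, hκ, ← this]; ring
    · simp [hκ, h.eta_zero hq1 P hP]
  rw [e1, e2]
  ring

end IntegralEquation

/-! ### The integral equation in the variable a, across a = 0 -/

section FlatEquation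

lemma ExpGrowth.mono {A : Type*} [NormedAddCommGroup A] [NormedSpace ℝ A] {c d : ℝ} {f : ℝ → A}
    (hf : ExpGrowth c f) (h : c ≤ d) : ExpGrowth d f := by
  refine ⟨hf.1, fun k => ?_⟩
  obtain ⟨C, hC⟩ := hf.2 k
  have hC0 : 0 ≤ C := by simpa using (norm_nonneg _).trans (hC 0)
  refine ⟨C, fun x => (hC x).trans (mul_le_mul_of_nonneg_left ?_ hC0)⟩
  exact Real.exp_le_exp.2 (mul_le_mul_of_nonneg_right h (abs_nonneg x))

/-- The profile functions of the coefficients of the integral equation. -/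
noncomputable def profile (l q j k : ℕ) (x : ℝ) : UnitFun :=
  expFun ((q * (j + 1) * l : ℕ) * x) * volterra (expFun (-(l : ℝ) * x)) ^ k

/-- The first factor has rate q(j+1)l and the power has rate kl; with j + 1 ≤ K and k ≤ qK + 1 one
rate serves all terms of the sum. -/
lemma expGrowth_profile {l q K j k : ℕ} (hj : j < K) (hk : k ≤ q * (j + 1) + 1) :
    ExpGrowth ((2 * (q * K * l) + l : ℕ) : ℝ) (profile l q j k) := by
  have h1 := (expGrowth_expFun ((q * (j + 1) * l : ℕ) : ℝ)).mul
    (((expGrowth_expFun (-(l : ℝ))).clm volterra).pow k)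
  refine h1.mono ?_
  rw [abs_neg, Nat.abs_cast, Nat.abs_cast]
  have h2 : q * (j + 1) ≤ q * K := Nat.mul_le_mul_left q hj
  have h3 : q * (j + 1) * l + k * l ≤ 2 * (q * K * l) + l := by nlinarith
  exact_mod_cast h3

/-- The right-hand side of the integral equation in the variable `a = (u / u₀) ^ (1 / l)`, extended
by zero to `a ≤ 0`. -/
noncomputable def remainderFlat (p q K l : ℕ) (u₀ : ℝ) (c : ℕ → ℕ → ℝ) (a α ν κ Y : ℝ)
    (R : UnitFun) : UnitFun :=
  ∑ i ∈ Finset.range (K + 1), ∑ j ∈ Finset.range K, (c i j * ν ^ i) •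
    ∑ k ∈ Finset.range (q * (j + 1) + 1 + 1),
      (κ ^ k * ((-(l : ℝ)) ^ (k + 1) * (u₀ ^ p) ^ (j + 1) * ((q * (j + 1) + 1).choose k : ℝ))) •
        (flatLog (l * (p * (j + 1))) (k + 1) (profile l q j k) (a, α)
          * (Y • (1 : UnitFun) + R) ^ (q * (j + 1) + 1 - k))

lemma remainderFlat_of_nonpos (p q K l : ℕ) (u₀ : ℝ) (c : ℕ → ℕ → ℝ) {a : ℝ} (ha : a ≤ 0)
    (α ν κ Y : ℝ) (R : UnitFun) : remainderFlat p q K l u₀ c a α ν κ Y R = 0 := by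
  simp [remainderFlat, flatLog, not_lt.2 ha]

/-- Binomial expansion in the compensator term and Y + R. With T = -l log a, the time factor and the
k compensators together contribute (-l log a)^(k+1). -/
lemma remainderFlat_of_pos (p q K l : ℕ) (u₀ : ℝ) (c : ℕ → ℕ → ℝ) {a : ℝ} (ha : 0 < a)
    (α ν κ Y : ℝ) (R : UnitFun) : remainderFlat p q K l u₀ c a α ν κ Y R
      = remainderField q K c (-(l : ℝ) * Real.log a) α ν ((u₀ * a ^ l) ^ p) κ Y R := by
  refine Finset.sum_congr rfl fun i _ => Finset.sum_congr rfl fun j _ => ?_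
  rw [mul_smul (c i j * ν ^ i)]
  congr 1
  have e0 : Y • (1 : UnitFun) + κ • compFun (-(l : ℝ) * Real.log a) α + R
      = κ • compFun (-(l : ℝ) * Real.log a) α + (Y • (1 : UnitFun) + R) := by abel
  rw [e0, add_pow, Finset.mul_sum, Finset.smul_sum]
  refine Finset.sum_congr rfl fun k _ => ?_
  have e1 : profile l q j k (α * Real.log a)
      = expFun (-(q * (j + 1) : ℕ) * α * (-(l : ℝ) * Real.log a))
        * volterra (expFun (α * (-(l : ℝ) * Real.log a))) ^ k := by
    rw [profile]
    congr 2
    · push_cast; ring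
    · congr 2; ring
  rw [flatLog_of_pos ha, e1]
  ext s
  simp only [compFun, ContinuousMap.smul_apply, ContinuousMap.mul_apply, ContinuousMap.pow_apply,
    smul_eq_mul, ContinuousMap.natCast_apply]
  generalize -(l : ℝ) = b
  ring

/-- Since p ≥ 1, the exponent l p (j+1) of a is at least l ≥ n + 1, as `contDiffAt_flatLog`
requires. -/
lemma contDiffAt_remainderFlat {W : Type*} [NormedAddCommGroup W] [NormedSpace ℝ W] {p q K l n : ℕ}
    (hp : 0 < p) (hn : n + 1 ≤ l) (u₀ : ℝ) {c : W → ℕ → ℕ → ℝ} {a α ν κ Y : W → ℝ} {R : W → UnitFun}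
    {z : W} (hc : ∀ i j, ContDiffAt ℝ n (fun w => c w i j) z) (ha : ContDiffAt ℝ n a z)
    (hα : ContDiffAt ℝ n α z) (hν : ContDiffAt ℝ n ν z) (hκ : ContDiffAt ℝ n κ z)
    (hY : ContDiffAt ℝ n Y z) (hR : ContDiffAt ℝ n R z)
    (hz : ((2 * (q * K * l) + l : ℕ) : ℝ) * |α z| < 1) :
    ContDiffAt ℝ n (fun w => remainderFlat p q K l u₀ (c w) (a w) (α w) (ν w) (κ w) (Y w) (R w))
      z := by
  obtain ⟨δ, hδ1, hδ2⟩ : ∃ δ, |α z| < δ ∧ ((2 * (q * K * l) + l : ℕ) : ℝ) * δ < 1 := by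
    have h1 : ContinuousAt (fun δ : ℝ => ((2 * (q * K * l) + l : ℕ) : ℝ) * δ) |α z| := by fun_prop
    have h2 := h1.eventually_lt_const hz
    have h3 : ∀ᶠ δ in 𝓝[>] |α z|, ((2 * (q * K * l) + l : ℕ) : ℝ) * δ < 1 :=
      nhdsWithin_le_nhds h2
    obtain ⟨δ, h4, h5⟩ := (h3.and self_mem_nhdsWithin).exists
    exact ⟨δ, h5, h4⟩
  refine ContDiffAt.sum fun i _ => ContDiffAt.sum fun j hj => ?_
  refine ((hc i j).mul (hν.pow i)).smul (ContDiffAt.sum fun k hk => ?_)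
  refine ((hκ.pow k).mul contDiffAt_const).smul (ContDiffAt.mul ?_ ?_)
  · have hM : n + 1 ≤ l * (p * (j + 1)) :=
      hn.trans (Nat.le_mul_of_pos_right l (by positivity))
    have h := contDiffAt_flatLog (Nat.cast_nonneg _) hδ2 n
      (expGrowth_profile (l := l) (q := q) (Finset.mem_range.1 hj)
        (Nat.lt_succ_iff.1 (Finset.mem_range.1 hk))) (k + 1) hM (x := (a z, α z)) hδ1
    exact h.comp z (ha.prodMk hα)
  · exact ((hY.smul contDiffAt_const).add hR).pow _

end FlatEquation

/-! ### The remainder via the implicit function theorem -/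

section SmoothRemainder

variable {m : ℕ}

lemma contDiffAt_of_contDiffOn_top {W : Type*} [NormedAddCommGroup W] [NormedSpace ℝ W]
    {L : Set (Param m)} (hL : IsOpen L) {f : Param m → ℝ} (hf : ContDiffOn ℝ ∞ f L) {n : ℕ}
    {P : W → Param m} {z : W} (hP : ContDiffAt ℝ n P z) (hz : P z ∈ L) :
    ContDiffAt ℝ n (fun w => f (P w)) z :=
  ((hf.contDiffAt (hL.mem_nhds hz)).of_le (by exact_mod_cast le_top)).comp z hP

lemma DulacSaddle.IsSmoothPolyFamily.contDiffAt_eval {W : Type*} [NormedAddCommGroup W]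
    [NormedSpace ℝ W] {L : Set (Param m)} {K : ℕ} {f : Param m → ℝ[X]}
    (hf : IsSmoothPolyFamily L K f) (hL : IsOpen L) {n : ℕ} {P : W → Param m} {ν : W → ℝ} {z : W}
    (hP : ContDiffAt ℝ n P z) (hν : ContDiffAt ℝ n ν z) (hz : P z ∈ L) :
    ContDiffAt ℝ n (fun w => (f (P w)).eval (ν w)) z := by
  have h : ContDiffAt ℝ n (fun w => ∑ i ∈ Finset.range (K + 1), (f (P w)).coeff i * ν w ^ i) z :=
    ContDiffAt.sum fun i _ => (contDiffAt_of_contDiffOn_top hL (hf.2 i) hP hz).mul (hν.pow i)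
  refine h.congr_of_eventuallyEq ?_
  filter_upwards [hP.continuousAt.eventually (hL.mem_nhds hz)] with w hw
  exact eval_eq_sum_range' (Nat.lt_succ_of_le (hf.1 _ hw)) _

/-- The right-hand side of the integral equation as a function of `(Y, a, v, P)` and the unknown,
where `u = u₀ a ^ l`. -/
noncomputable def flatField (p q K l : ℕ) (σ₀ u₀ : ℝ) (φ : Param m → ℝ[X])
    (Φ : Param m → MvPolynomial (Fin 2) ℝ) (η : Param m → ℝ[X])
    (z : (ℝ × ℝ × ℝ × Param m) × UnitFun) : UnitFun :=
  remainderFlat p q K l u₀ (coeffSucc (Φ z.1.2.2.2)) z.1.2.1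
    (alpha σ₀ φ z.1.2.2.2 (u₀ * z.1.2.1 ^ l * z.1.2.2.1)) (u₀ * z.1.2.1 ^ l * z.1.2.2.1)
    (z.1.2.2.1 ^ p * (η z.1.2.2.2).eval (u₀ * z.1.2.1 ^ l * z.1.2.2.1)) z.1.1 z.2

lemma isRemainder_iff_flatField (p q K l : ℕ) (σ₀ : ℝ) {u₀ : ℝ} (hu₀ : 0 < u₀) (φ : Param m → ℝ[X])
    (Φ : Param m → MvPolynomial (Fin 2) ℝ) (η : Param m → ℝ[X]) (P : Param m) (Y v : ℝ) {a : ℝ}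
    (ha : 0 < a) (R : UnitFun) : IsRemainder p q K σ₀ u₀ φ Φ η P Y (u₀ * a ^ l) v R ↔
      R = volterra (flatField p q K l σ₀ u₀ φ Φ η ((Y, a, v, P), R)) := by
  have e : Real.log (u₀ / (u₀ * a ^ l)) = -(l : ℝ) * Real.log a := by
    rw [Real.log_div hu₀.ne' (by positivity), Real.log_mul hu₀.ne' (by positivity), Real.log_pow]
    ring
  rw [IsRemainder, flatField, remainderFlat_of_pos _ _ _ _ _ _ ha, e]

open Classical in
/-- The remainder of the transition map. -/
noncomputable def transRemainder (p q K : ℕ) (σ₀ u₀ : ℝ) (φ : Param m → ℝ[X])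
    (Φ : Param m → MvPolynomial (Fin 2) ℝ) (η : Param m → ℝ[X]) (P : Param m) (Y u v : ℝ) : ℝ :=
  if h : ∃ R, IsRemainder p q K σ₀ u₀ φ Φ η P Y u v R then h.choose 1 else 0

lemma UnitFun.extend_zero (f : UnitFun) : f.extend 0 = f 0 := f.extend_coe 0

lemma UnitFun.extend_one (f : UnitFun) : f.extend 1 = f 1 := f.extend_coe 1

lemma volterra_zero (f : UnitFun) : volterra f 0 = 0 := by simp [volterra_apply]

lemma compFun_zero (T α : ℝ) : compFun T α 0 = 0 := by simp [compFun, volterra_zero]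

lemma fiberCurve_zero (σ T α κ Y : ℝ) {R : UnitFun} (hR : R 0 = 0) :
    fiberCurve σ T α κ Y R 0 = Y := by
  simp [fiberCurve, UnitFun.extend_zero, hR, compFun_zero]

lemma fiberCurve_end (σ α κ Y : ℝ) {T : ℝ} (hT : T ≠ 0) (R : UnitFun) :
    fiberCurve σ T α κ Y R T = Real.exp (-(σ * T)) * (Y + κ * compFun T α 1 + R 1) := by
  simp [fiberCurve, UnitFun.extend_one, div_self hT]

lemma IsRemainder.apply_zero {p q K : ℕ} {σ₀ u₀ : ℝ} {φ : Param m → ℝ[X]}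
    {Φ : Param m → MvPolynomial (Fin 2) ℝ} {η : Param m → ℝ[X]} {P : Param m} {Y u v : ℝ}
    {R : UnitFun} (hR : IsRemainder p q K σ₀ u₀ φ Φ η P Y u v R) : R 0 = 0 := by
  rw [IsRemainder] at hR
  rw [hR, volterra_zero]

/-- Any two solutions give trajectories with the same starting point, hence the same endpoint, and
the endpoint determines R(1). So the chosen value is canonical, and the same remainder serves every
l. -/
lemma IsRemainder.transRemainder_eq {p q K : ℕ} {σ₀ u₀ : ℝ} {L : Set (Param m)}
    {φ : Param m → ℝ[X]} {Φ : Param m → MvPolynomial (Fin 2) ℝ} {η : Param m → ℝ[X]}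
    (hq : 0 < q) (hσ₀ : σ₀ = (p : ℝ) / q) (h : IsResonantFamily q L K φ Φ η) {P : Param m}
    (hP : P ∈ L) {Y u v : ℝ} (hu : 0 < u) (huu : u < u₀) {R : UnitFun}
    (hR : IsRemainder p q K σ₀ u₀ φ Φ η P Y u v R) :
    transRemainder p q K σ₀ u₀ φ Φ η P Y u v = R 1 := by
  have hex : ∃ R, IsRemainder p q K σ₀ u₀ φ Φ η P Y u v R := ⟨R, hR⟩
  have hT : 0 < Real.log (u₀ / u) := Real.log_pos (by rwa [one_lt_div hu])
  rw [transRemainder, dif_pos hex]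
  have hR' := hex.choose_spec
  have := (hR'.isFiberSolution hq hσ₀ h hP hu huu).unique (contDiff_resonantField _ _ _ _ _ _)
    (fun _ => rfl) (fun _ => rfl) (hR.isFiberSolution hq hσ₀ h hP hu huu)
    (by rw [fiberCurve_zero _ _ _ _ _ hR.apply_zero, fiberCurve_zero _ _ _ _ _ hR'.apply_zero])
    (right_mem_Icc.2 hT.le)
  rw [fiberCurve_end _ _ _ _ hT.ne', fiberCurve_end _ _ _ _ hT.ne'] at this
  have h2 := mul_left_cancel₀ (Real.exp_pos _).ne' this
  linarith

lemma contDiffAt_flatField {p q K l n : ℕ} {σ₀ u₀ : ℝ} {μ₀ : EuclideanSpace ℝ (Fin m)}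
    {L : Set (Param m)} (hL : IsOpen L) (hL₀ : (μ₀, σ₀) ∈ L) {φ : Param m → ℝ[X]}
    {Φ : Param m → MvPolynomial (Fin 2) ℝ} {η : Param m → ℝ[X]} (hp : 0 < p)
    (h : IsResonantFamily q L K φ Φ η) (hn : n + 1 ≤ l) (Y v : ℝ) (R : UnitFun) :
    ContDiffAt ℝ n (flatField p q K l σ₀ u₀ φ Φ η) ((Y, 0, v, (μ₀, σ₀)), R) := by
  have hl : l ≠ 0 := by omega
  set z₀ : (ℝ × ℝ × ℝ × Param m) × UnitFun := ((Y, 0, v, (μ₀, σ₀)), R)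
  have hP : ContDiffAt ℝ n (fun z : (ℝ × ℝ × ℝ × Param m) × UnitFun => z.1.2.2.2) z₀ := by fun_prop
  have hν : ContDiffAt ℝ n (fun z : (ℝ × ℝ × ℝ × Param m) × UnitFun =>
    u₀ * z.1.2.1 ^ l * z.1.2.2.1) z₀ := by fun_prop
  have hφ := h.smooth_phi.contDiffAt_eval hL hP hν hL₀
  have hη := h.smooth_eta.contDiffAt_eval hL hP hν hL₀
  have hα : ContDiffAt ℝ n (fun z : (ℝ × ℝ × ℝ × Param m) × UnitFun =>
      alpha σ₀ φ z.1.2.2.2 (u₀ * z.1.2.1 ^ l * z.1.2.2.1)) z₀ :=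
    ((contDiffAt_snd.comp z₀ hP).add hφ).sub contDiffAt_const
  refine contDiffAt_remainderFlat hp hn u₀
    (fun i j => contDiffAt_of_contDiffOn_top hL (h.smooth_Phi.2 _) hP hL₀) (by fun_prop) hα hν
    (ContDiffAt.mul (by fun_prop) hη) (by fun_prop) (by fun_prop) ?_
  -- At a = 0 also ν = 0 (as l ≥ 1), hence α = 0 whatever Y and v are; the smallness condition on α
  -- is automatic.
  have h0 : alpha σ₀ φ (μ₀, σ₀) 0 = 0 := by
    simp [alpha, sigmaBar, h.phi_zero _ hL₀]
  simp [z₀, hl, h0]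

/-- The implicit function theorem for R minus the integrated right-hand side. At a = 0 that
right-hand side is zero for every R, so the partial derivative in R is the identity; neither Y nor v
has to be small. -/
lemma exists_local_remainder {p q K l n : ℕ} {σ₀ u₀ : ℝ} {μ₀ : EuclideanSpace ℝ (Fin m)}
    {L : Set (Param m)} (hL : IsOpen L) (hL₀ : (μ₀, σ₀) ∈ L) {φ : Param m → ℝ[X]}
    {Φ : Param m → MvPolynomial (Fin 2) ℝ} {η : Param m → ℝ[X]} (hp : 0 < p)
    (h : IsResonantFamily q L K φ Φ η) (hn0 : n ≠ 0) (hn : n + 1 ≤ l) (Y v : ℝ) :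
    ∃ ρ : ℝ × ℝ × ℝ × Param m → UnitFun, ContDiffAt ℝ n ρ (Y, 0, v, (μ₀, σ₀)) ∧
      ρ (Y, 0, v, (μ₀, σ₀)) = 0 ∧ ∀ᶠ x in 𝓝 ((Y, 0, v, (μ₀, σ₀)) : ℝ × ℝ × ℝ × Param m),
        ρ x = volterra (flatField p q K l σ₀ u₀ φ Φ η (x, ρ x)) := by
  set x₀ : ℝ × ℝ × ℝ × Param m := (Y, 0, v, (μ₀, σ₀)) with hx₀
  set f : (ℝ × ℝ × ℝ × Param m) × UnitFun → UnitFun := fun z =>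
    z.2 - volterra (flatField p q K l σ₀ u₀ φ Φ η z) with hf
  have hcd : ContDiffAt ℝ n f (x₀, 0) :=
    contDiffAt_snd.sub (volterra.contDiff.contDiffAt.comp (x₀, 0)
      (contDiffAt_flatField hL hL₀ hp h hn Y v 0))
  have hn0' : (n : ℕ∞ω) ≠ 0 := by exact_mod_cast hn0
  have hfx : ∀ R, f (x₀, R) = R := fun R => by
    simp [hf, flatField, hx₀, remainderFlat_of_nonpos]
  have hderiv : fderiv ℝ f (x₀, 0) ∘L .inr ℝ _ _ = ContinuousLinearMap.id ℝ UnitFun := by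
    have h1 : HasFDerivAt f (fderiv ℝ f (x₀, 0)) (x₀, 0) :=
      (hcd.differentiableAt hn0').hasFDerivAt
    have h2 : HasFDerivAt (fun R : UnitFun => (x₀, R)) (.inr ℝ _ _) (0 : UnitFun) :=
      hasFDerivAt_prodMk_right x₀ 0
    have h3 := HasFDerivAt.comp (0 : UnitFun) h1 h2
    have h4 : f ∘ (fun R : UnitFun => (x₀, R)) = id := funext hfx
    rw [h4] at h3
    exact h3.unique (hasFDerivAt_id 0)
  have hinv : (fderiv ℝ f (x₀, 0) ∘L .inr ℝ _ _).IsInvertible :=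
    ⟨ContinuousLinearEquiv.refl ℝ UnitFun, by rw [hderiv]; rfl⟩
  refine ⟨hcd.implicitFunction hn0' hinv, hcd.contDiffAt_implicitFunction hn0' hinv,
    hcd.implicitFunction_apply_self hn0' hinv, ?_⟩
  filter_upwards [hcd.eventually_apply_implicitFunction hn0' hinv] with x hx
  rw [hfx 0] at hx
  exact sub_eq_zero.1 hx

/-- The remainder as a function of `(Y, a, v, P)` with `u = u₀ a ^ l`, extended by zero to
`a ≤ 0`. -/
noncomputable def remainderExt (p q K l : ℕ) (σ₀ u₀ : ℝ) (φ : Param m → ℝ[X])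
    (Φ : Param m → MvPolynomial (Fin 2) ℝ) (η : Param m → ℝ[X]) (x : ℝ × ℝ × ℝ × Param m) : ℝ :=
  if 0 < x.2.1 then transRemainder p q K σ₀ u₀ φ Φ η x.2.2.2 x.1 (u₀ * x.2.1 ^ l) x.2.2.1 else 0

/-- For a > 0 the implicit function is a solution, so its value at 1 is the remainder; for a ≤ 0 it
vanishes, as the extension does. -/
lemma contDiffAt_remainderExt {p q K l n : ℕ} {σ₀ u₀ : ℝ} (hu₀ : 0 < u₀)
    {μ₀ : EuclideanSpace ℝ (Fin m)}
    {L : Set (Param m)} (hL : IsOpen L) (hL₀ : (μ₀, σ₀) ∈ L) {φ : Param m → ℝ[X]}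
    {Φ : Param m → MvPolynomial (Fin 2) ℝ} {η : Param m → ℝ[X]} (hp : 0 < p) (hq : 0 < q)
    (hσ₀ : σ₀ = (p : ℝ) / q)
    (h : IsResonantFamily q L K φ Φ η) (hn0 : n ≠ 0) (hn : n + 1 ≤ l) (Y v : ℝ) :
    ContDiffAt ℝ n (remainderExt p q K l σ₀ u₀ φ Φ η) (Y, 0, v, (μ₀, σ₀)) ∧
      ∀ᶠ x in 𝓝 ((Y, 0, v, (μ₀, σ₀)) : ℝ × ℝ × ℝ × Param m), 0 < x.2.1 →
        ∃ R, IsRemainder p q K σ₀ u₀ φ Φ η x.2.2.2 x.1 (u₀ * x.2.1 ^ l) x.2.2.1 R ∧ ‖R‖ ≤ 1 := by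
  obtain ⟨ρ, hρ, hρ0, hev⟩ := exists_local_remainder (u₀ := u₀) hL hL₀ hp h hn0 hn Y v
  have hsol : ∀ᶠ x in 𝓝 ((Y, 0, v, (μ₀, σ₀)) : ℝ × ℝ × ℝ × Param m), 0 < x.2.1 →
      IsRemainder p q K σ₀ u₀ φ Φ η x.2.2.2 x.1 (u₀ * x.2.1 ^ l) x.2.2.1 (ρ x) := by
    filter_upwards [hev] with x hx ha
    exact (isRemainder_iff_flatField p q K l σ₀ hu₀ φ Φ η _ _ _ ha _).2 hx
  constructor
  · have he : ContDiff ℝ n (fun f : UnitFun => f 1) :=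
      (ContinuousMap.evalCLM ℝ (1 : unitInterval) : UnitFun →L[ℝ] ℝ).contDiff
    have h1 : ContDiffAt ℝ n (fun x => ρ x 1) (Y, 0, v, (μ₀, σ₀)) :=
      he.contDiffAt.comp _ hρ
    refine h1.congr_of_eventuallyEq ?_
    have hPL : ∀ᶠ x in 𝓝 ((Y, 0, v, (μ₀, σ₀)) : ℝ × ℝ × ℝ × Param m), x.2.2.2 ∈ L :=
      (hL.preimage (by fun_prop : Continuous fun x : ℝ × ℝ × ℝ × Param m => x.2.2.2)).mem_nhds hL₀
    have ha1 : ∀ᶠ x in 𝓝 ((Y, 0, v, (μ₀, σ₀)) : ℝ × ℝ × ℝ × Param m), x.2.1 < 1 :=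
      (isOpen_Iio.preimage (by fun_prop : Continuous fun x : ℝ × ℝ × ℝ × Param m => x.2.1)).mem_nhds
        (by simp)
    filter_upwards [hev, hsol, hPL, ha1] with x hx hs hP ha
    by_cases h0 : 0 < x.2.1
    · rw [remainderExt, if_pos h0]
      refine (hs h0).transRemainder_eq hq hσ₀ h hP (by positivity) ?_
      exact mul_lt_of_lt_one_right hu₀ (pow_lt_one₀ h0.le ha (by omega))
    · rw [remainderExt, if_neg h0, hx, flatField, remainderFlat_of_nonpos _ _ _ _ _ _ (not_lt.1 h0)]
      simp
  · have h2 : ∀ᶠ x in 𝓝 ((Y, 0, v, (μ₀, σ₀)) : ℝ × ℝ × ℝ × Param m), ‖ρ x‖ < 1 :=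
      hρ.continuousAt.norm.eventually_lt_const (by simp [hρ0])
    filter_upwards [hsol, h2] with x hx hx2 ha using ⟨ρ x, hx ha, hx2.le⟩

end SmoothRemainder

/-! ### Estimates for the compensator as an integral -/

section CompensatorBounds

/-- The integral `∫ τ in 0..t, exp (α τ)`. -/
noncomputable def expInt (α t : ℝ) : ℝ := ∫ τ in (0 : ℝ)..t, Real.exp (α * τ)

lemma intervalIntegrable_exp (α a b : ℝ) :
    IntervalIntegrable (fun τ => Real.exp (α * τ)) MeasureTheory.volume a b :=
  Continuous.intervalIntegrable (by fun_prop) _ _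

lemma integral_expFun (x : ℝ) (s : unitInterval) :
    ∫ τ in (0 : ℝ)..s, (expFun x).extend τ = ∫ τ in (0 : ℝ)..s, Real.exp (x * τ) := by
  refine intervalIntegral.integral_congr fun τ hτ => ?_
  rw [uIcc_of_le s.2.1] at hτ
  exact (expFun x).extend_coe ⟨τ, hτ.1, hτ.2.trans s.2.2⟩

lemma compFun_apply (T α : ℝ) (s : unitInterval) : compFun T α s = expInt α (T * s) := by
  rw [compFun, ContinuousMap.smul_apply, volterra_apply, integral_expFun, smul_eq_mul, expInt]
  have h := intervalIntegral.mul_integral_comp_mul_left (a := 0) (b := (s : ℝ))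
    (f := fun τ => Real.exp (α * τ)) T
  rw [mul_zero] at h
  rw [← h]
  simp only [mul_assoc]

lemma compensator_eq_expInt {ξ : ℝ} (hξ : 0 < ξ) (α : ℝ) :
    compensator ξ α = expInt α (-Real.log ξ) := by
  rw [compensator, expInt]
  split_ifs with h
  · simp [h]
  · have h1 := intervalIntegral.mul_integral_comp_mul_left (a := 0) (b := -Real.log ξ)
      (f := Real.exp) α
    rw [integral_exp, mul_zero, Real.exp_zero] at h1
    rw [div_eq_iff h, mul_comm _ α, h1, Real.rpow_def_of_pos hξ]
    congr 2
    ring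

lemma expInt_mono {α s t : ℝ} (hst : s ≤ t) : expInt α s ≤ expInt α t := by
  have h := intervalIntegral.integral_add_adjacent_intervals
    (intervalIntegrable_exp α 0 s) (intervalIntegrable_exp α s t)
  have h2 : 0 ≤ ∫ τ in s..t, Real.exp (α * τ) :=
    intervalIntegral.integral_nonneg hst fun _ _ => (Real.exp_pos _).le
  simp only [expInt]
  linarith

lemma expInt_nonneg {α t : ℝ} (ht : 0 ≤ t) : 0 ≤ expInt α t :=
  intervalIntegral.integral_nonneg ht fun _ _ => (Real.exp_pos _).le

lemma expInt_le {α t : ℝ} (ht : 0 ≤ t) : expInt α t ≤ t * Real.exp (|α| * t) := by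
  have h := intervalIntegral.norm_integral_le_of_norm_le_const (a := 0) (b := t)
    (f := fun τ => Real.exp (α * τ)) (C := Real.exp (|α| * t)) (fun x hx => by
      rw [uIoc_of_le ht] at hx
      rw [Real.norm_eq_abs, Real.abs_exp, Real.exp_le_exp]
      exact (mul_le_mul_of_nonneg_right (le_abs_self α) hx.1.le).trans
        (mul_le_mul_of_nonneg_left hx.2 (abs_nonneg α)))
  rw [sub_zero, abs_of_nonneg ht, mul_comm] at h
  exact (le_abs_self _).trans h

lemma exp_mul_expInt (α s t : ℝ) :
    Real.exp (α * s) * expInt α t = ∫ τ in s..(t + s), Real.exp (α * τ) := by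
  have h := intervalIntegral.integral_comp_add_right (a := 0) (b := t)
    (fun τ => Real.exp (α * τ)) s
  rw [zero_add] at h
  rw [← h, expInt, ← intervalIntegral.integral_const_mul]
  refine intervalIntegral.integral_congr fun τ _ => ?_
  rw [← Real.exp_add]
  ring_nf

lemma integral_le_expInt {α s t T : ℝ} (hs : 0 ≤ s) (ht : t ≤ T) :
    ∫ τ in s..t, Real.exp (α * τ) ≤ expInt α T := by
  have h := intervalIntegral.integral_add_adjacent_intervals
    (intervalIntegrable_exp α 0 s) (intervalIntegrable_exp α s t)
  have h1 : 0 ≤ expInt α s := expInt_nonneg hs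
  have h2 := expInt_mono (α := α) ht
  simp only [expInt] at h1 h2 ⊢
  linarith

/-- The unit interval starting at min r (T - 1) lies in [0,T] and contains r; on it e^(ατ) ≥
e^(αr-1) because |α| ≤ 1. -/
lemma exp_le_expInt {α r T : ℝ} (hα : |α| ≤ 1) (hT : 1 ≤ T) (hr : 0 ≤ r) (hrT : r ≤ T) :
    Real.exp (α * r) ≤ Real.exp 1 * expInt α T := by
  set s := min r (T - 1) with hs
  have hsr : s ≤ r := min_le_left _ _
  have hsT : s + 1 ≤ T := by linarith [min_le_right r (T - 1)]
  have hs0 : 0 ≤ s := le_min hr (by linarith)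
  have hrs : r ≤ s + 1 := by
    rcases min_choice r (T - 1) with h | h <;> rw [← hs] at h <;> linarith
  have h1 : Real.exp (α * r - 1) ≤ ∫ τ in s..(s + 1), Real.exp (α * τ) := by
    have h2 : ∫ _ in s..(s + 1), Real.exp (α * r - 1) ≤ ∫ τ in s..(s + 1), Real.exp (α * τ) := by
      refine intervalIntegral.integral_mono_on (by linarith) (by simp)
        (intervalIntegrable_exp _ _ _) fun τ hτ => Real.exp_le_exp.2 ?_
      have h3 : |α * (r - τ)| ≤ 1 := by
        rw [abs_mul]
        exact mul_le_one₀ hα (abs_nonneg _) (abs_le.2 ⟨by linarith [hτ.2], by linarith [hτ.1]⟩)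
      have := (abs_le.1 h3).2
      linarith
    simpa using h2
  have h4 := h1.trans (integral_le_expInt hs0 hsT)
  have h5 : Real.exp (α * r) = Real.exp 1 * Real.exp (α * r - 1) := by
    rw [← Real.exp_add]; ring_nf
  rw [h5]
  exact mul_le_mul_of_nonneg_left h4 (Real.exp_pos _).le

lemma one_add_expInt_le {α t T : ℝ} (hα : |α| ≤ 1) (hT : 1 ≤ T) (htT : t ≤ T) :
    1 + expInt α t ≤ (Real.exp 1 + 1) * expInt α T := by
  have h1 := exp_le_expInt hα hT le_rfl (by linarith : (0 : ℝ) ≤ T)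
  rw [mul_zero, Real.exp_zero] at h1
  linarith [expInt_mono (α := α) htT]

/-- Translation turns e^(-αt) ∫_0^t e^(ατ) dτ into e^(-αT) times the integral over [T-t, T], a part
of [0,T]. The summand 1 is handled by `exp_le_expInt`. -/
lemma exp_mul_one_add_expInt_le {α t T : ℝ} (hα : |α| ≤ 1) (hT : 1 ≤ T) (ht : 0 ≤ t)
    (htT : t ≤ T) : Real.exp (-(α * t)) * (1 + expInt α t)
      ≤ (Real.exp 1 + 1) * (Real.exp (-(α * T)) * expInt α T) := by
  have h1 := exp_le_expInt hα hT (by linarith : (0 : ℝ) ≤ T - t) (by linarith)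
  have h2 := exp_mul_expInt α (T - t) t
  rw [add_sub_cancel] at h2
  have h3 := integral_le_expInt (α := α) (sub_nonneg.2 htT) (le_refl T)
  rw [← h2] at h3
  have h4 : Real.exp (-(α * t)) = Real.exp (-(α * T)) * Real.exp (α * (T - t)) := by
    rw [← Real.exp_add]; ring_nf
  rw [h4, mul_assoc, mul_left_comm (Real.exp 1 + 1)]
  refine mul_le_mul_of_nonneg_left ?_ (Real.exp_pos _).le
  linarith

/-- The reflection τ ↦ T - τ changes the sign of α and reduces the claim to `expInt_le`. -/
lemma exp_neg_mul_expInt_le {α T : ℝ} (hT : 0 ≤ T) :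
    Real.exp (-(α * T)) * expInt α T ≤ T * Real.exp (|α| * T) := by
  have h : Real.exp (-(α * T)) * expInt α T = expInt (-α) T := by
    have h1 := intervalIntegral.integral_comp_sub_left (a := 0) (b := T)
      (fun τ => Real.exp (-α * τ)) T
    rw [sub_self, sub_zero] at h1
    rw [expInt, expInt, ← h1, ← intervalIntegral.integral_const_mul]
    refine intervalIntegral.integral_congr fun τ _ => ?_
    rw [← Real.exp_add]; ring_nf
  rw [h, ← abs_neg α]
  exact expInt_le hT

end CompensatorBounds

/-! ### Pointwise bound for the right-hand side -/

section RemainderBound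

lemma abs_volterra_le (f : UnitFun) {C : ℝ} (hC : ∀ s, |f s| ≤ C) (s : unitInterval) :
    |volterra f s| ≤ C := by
  have h := intervalIntegral.norm_integral_le_of_norm_le_const (a := (0 : ℝ)) (b := (s : ℝ))
    (f := f.extend) (C := C) (fun x _ => hC _)
  rw [sub_zero, abs_of_nonneg s.2.1] at h
  exact h.trans (mul_le_of_le_one_right ((abs_nonneg _).trans (hC s)) s.2.2)

lemma abs_fiber_le {B T α κ Y : ℝ} (hT : 0 ≤ T) (hκ : |κ| ≤ B) (hY : |Y| ≤ 1) {R : UnitFun}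
    (hR : ‖R‖ ≤ 1) (s : unitInterval) :
    |Y + κ * compFun T α s + R s| ≤ (2 + B) * (1 + expInt α (T * s)) := by
  have hw : 0 ≤ expInt α (T * s) := expInt_nonneg (mul_nonneg hT s.2.1)
  have hB : 0 ≤ B := (abs_nonneg _).trans hκ
  have h1 : |R s| ≤ 1 := (R.norm_coe_le_norm s).trans hR
  have h2 : |κ * compFun T α s| ≤ B * expInt α (T * s) := by
    rw [abs_mul, compFun_apply, abs_of_nonneg hw]
    exact mul_le_mul_of_nonneg_right hκ hw
  have h3 := abs_add_three Y (κ * compFun T α s) (R s)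
  nlinarith

lemma abs_remainderField_le {q K : ℕ} {c : ℕ → ℕ → ℝ} {B M T α ν U κ Y : ℝ} {R : UnitFun}
    (hU : 0 ≤ U) (hT : 1 ≤ T) (hα : |α| ≤ 1) (hν : |ν| ≤ 1) (hc : ∀ i j, i ≤ K → j < K → |c i j| ≤ B)
    (hB : 0 ≤ B)
    (hκ : |κ| ≤ B) (hY : |Y| ≤ 1) (hR : ‖R‖ ≤ 1)
    (hM : U * (Real.exp (-(α * T)) * expInt α T) ^ q ≤ M) (s : unitInterval) :
    |remainderField q K c T α ν U κ Y R s| ≤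
      ((K + 1) * B * (∑ j ∈ Finset.range K, ((2 + B) * (Real.exp 1 + 1)) ^ (q * j) * M ^ j)
        * ((2 + B) * (Real.exp 1 + 1)) ^ (q + 1))
        * (T * (U * Real.exp (-(q * α * T)) * expInt α T ^ (q + 1))) := by
  set t := T * (s : ℝ) with ht
  set D := 2 + B with hD
  set E := Real.exp 1 + 1 with hE
  have hD0 : 0 ≤ D := by positivity
  have hE0 : 0 ≤ E := by positivity
  have hT0 : 0 ≤ T := by linarith
  have ht0 : 0 ≤ t := mul_nonneg hT0 s.2.1
  have htT : t ≤ T := mul_le_of_le_one_right hT0 s.2.2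
  set w := expInt α T with hw
  have hw0 : 0 ≤ w := expInt_nonneg hT0
  have hwt0 : 0 ≤ expInt α t := expInt_nonneg ht0
  set H := U * (Real.exp (-(α * T)) * w) ^ q with hH
  have hH0 : 0 ≤ H := by positivity
  set Z := Y + κ * compFun T α s + R s with hZ
  have hZ1 : |Z| ≤ D * (1 + expInt α t) := abs_fiber_le hT0 hκ hY hR s
  have hZ2 : |Z| ≤ D * E * w := by
    rw [mul_assoc]
    exact hZ1.trans (mul_le_mul_of_nonneg_left (one_add_expInt_le hα hT htT) hD0)
  set X := U * Real.exp (-(q * α * t)) * Z ^ q with hX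
  -- X is the second argument of Φ at time t, and H is its scale at the final time. In X^(j+1) one
  -- factor is bounded by H and the other j by M; the outer factor Z then raises the power of w from
  -- q to q + 1.
  have hXH : |X| ≤ (D * E) ^ q * H := by
    have h1 : |X| = U * (Real.exp (-(α * t)) * |Z|) ^ q := by
      rw [hX, abs_mul, abs_mul, abs_of_nonneg hU, Real.abs_exp, abs_pow, mul_pow,
        ← Real.exp_nat_mul]
      ring_nf
    have h2 : Real.exp (-(α * t)) * |Z| ≤ D * E * (Real.exp (-(α * T)) * w) := by
      calc Real.exp (-(α * t)) * |Z| ≤ Real.exp (-(α * t)) * (D * (1 + expInt α t)) :=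
            mul_le_mul_of_nonneg_left hZ1 (Real.exp_pos _).le
        _ = D * (Real.exp (-(α * t)) * (1 + expInt α t)) := by ring
        _ ≤ D * (E * (Real.exp (-(α * T)) * w)) :=
            mul_le_mul_of_nonneg_left (exp_mul_one_add_expInt_le hα hT ht0 htT) hD0
        _ = _ := by ring
    rw [h1, hH, mul_left_comm _ U, ← mul_pow (D * E)]
    exact mul_le_mul_of_nonneg_left (pow_le_pow_left₀ (by positivity) h2 q) hU
  have hXM : |X| ≤ (D * E) ^ q * M := hXH.trans (mul_le_mul_of_nonneg_left hM (by positivity))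
  have hM0 : 0 ≤ M := hH0.trans hM
  have hsum : |∑ i ∈ Finset.range (K + 1), ∑ j ∈ Finset.range K, c i j * ν ^ i * X ^ (j + 1)|
      ≤ (K + 1) * B * (∑ j ∈ Finset.range K, (D * E) ^ (q * j) * M ^ j) * |X| := by
    have h1 : ∀ i ∈ Finset.range (K + 1), |∑ j ∈ Finset.range K, c i j * ν ^ i * X ^ (j + 1)|
        ≤ B * (∑ j ∈ Finset.range K, (D * E) ^ (q * j) * M ^ j) * |X| := by
      intro i hi
      rw [mul_assoc, Finset.sum_mul, Finset.mul_sum]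
      refine (Finset.abs_sum_le_sum_abs _ _).trans (Finset.sum_le_sum fun j hj => ?_)
      rw [abs_mul, abs_mul, abs_pow, abs_pow, pow_succ, pow_mul, ← mul_pow]
      have h2 : |c i j| * |ν| ^ i ≤ B * 1 :=
        mul_le_mul (hc i j (Nat.lt_succ_iff.1 (Finset.mem_range.1 hi)) (Finset.mem_range.1 hj))
          (pow_le_one₀ (abs_nonneg _) hν) (by positivity) hB
      rw [mul_one] at h2
      exact mul_le_mul h2 (mul_le_mul_of_nonneg_right (pow_le_pow_left₀ (abs_nonneg _) hXM j)
        (abs_nonneg _)) (by positivity) hB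
    refine (Finset.abs_sum_le_sum_abs _ _).trans ((Finset.sum_le_sum h1).trans (le_of_eq ?_))
    rw [Finset.sum_const, Finset.card_range, nsmul_eq_mul]
    push_cast; ring
  rw [remainderField_apply, abs_mul, abs_mul, abs_of_nonneg hT0]
  have hS0 : 0 ≤ ∑ j ∈ Finset.range K, (D * E) ^ (q * j) * M ^ j :=
    Finset.sum_nonneg fun j _ => by positivity
  set Sg := ∑ j ∈ Finset.range K, (D * E) ^ (q * j) * M ^ j
  have hHw : H * w = U * Real.exp (-(q * α * T)) * w ^ (q + 1) := by
    rw [hH, mul_pow, ← Real.exp_nat_mul, pow_succ]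
    ring_nf
  calc _ ≤ T * ((K + 1) * B * Sg * |X|) * |Z| := by
        gcongr
    _ ≤ T * ((K + 1) * B * Sg * ((D * E) ^ q * H)) * (D * E * w) := by gcongr
    _ = ((K + 1) * B * Sg * (D * E) ^ (q + 1)) * (T * (H * w)) := by ring
    _ = _ := by rw [hHw]

/-- As p ≥ 1 there is a factor e^(-T): half of it absorbs e^(q|α|T), the other half absorbs T^q at
the cost of 2^q q!. -/
lemma pow_mul_exp_expInt_le {p q : ℕ} (hp : 0 < p) {u₀ T α : ℝ} (hu₀ : 0 < u₀) (hT : 0 ≤ T)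
    (hα : q * |α| ≤ 1 / 2) :
    (u₀ * Real.exp (-T)) ^ p * (Real.exp (-(α * T)) * expInt α T) ^ q
      ≤ u₀ ^ p * (2 ^ q * q.factorial) := by
  have h1 : (Real.exp (-(α * T)) * expInt α T) ^ q ≤ (T * Real.exp (|α| * T)) ^ q :=
    pow_le_pow_left₀ (mul_nonneg (Real.exp_pos _).le (expInt_nonneg hT))
      (exp_neg_mul_expInt_le hT) q
  have h2 : Real.exp (-T) ^ p ≤ Real.exp (-T) :=
    pow_le_of_le_one (Real.exp_pos _).le (Real.exp_le_one_iff.2 (by linarith)) hp.ne'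
  have h3 : Real.exp (|α| * T) ^ q ≤ Real.exp (T / 2) := by
    rw [← Real.exp_nat_mul, Real.exp_le_exp]
    nlinarith
  have h4 := Real.pow_div_factorial_le_exp (T / 2) (by positivity) q
  have h5 : T ^ q ≤ Real.exp (T / 2) * (2 ^ q * q.factorial) := by
    rw [div_pow, div_div, div_le_iff₀ (by positivity)] at h4
    exact h4
  have h6 : Real.exp (-T) * (Real.exp (T / 2) * Real.exp (T / 2)) = 1 := by
    rw [← Real.exp_add, ← Real.exp_add]; simp
  rw [mul_pow, mul_assoc]
  refine mul_le_mul_of_nonneg_left ?_ (by positivity)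
  calc Real.exp (-T) ^ p * (Real.exp (-(α * T)) * expInt α T) ^ q
      ≤ Real.exp (-T) * (T * Real.exp (|α| * T)) ^ q :=
        mul_le_mul h2 h1 (pow_nonneg (mul_nonneg (Real.exp_pos _).le (expInt_nonneg hT)) q)
          (Real.exp_pos _).le
    _ = Real.exp (-T) * (T ^ q * Real.exp (|α| * T) ^ q) := by rw [mul_pow]
    _ ≤ Real.exp (-T) * ((Real.exp (T / 2) * (2 ^ q * q.factorial)) * Real.exp (T / 2)) := by
        gcongr
    _ = 2 ^ q * q.factorial := by linear_combination (2 ^ q * (q.factorial : ℝ)) * h6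

end RemainderBound

/-! ### Uniform neighbourhoods, landing and the bound on the remainder -/

section UniformRegion

variable {m : ℕ}

/-- The tube lemma over the compact rectangle of (Y, v). The choices Y₁ = 1 and v₁ ≤ 1 in the
resonant case come from this rectangle. -/
lemma eventually_uniform {μ₀ : EuclideanSpace ℝ (Fin m)} {σ₀ : ℝ}
    {Q : ℝ × ℝ × ℝ × Param m → Prop}
    (h : ∀ Y v : ℝ, ∀ᶠ x in 𝓝 ((Y, 0, v, (μ₀, σ₀)) : ℝ × ℝ × ℝ × Param m), Q x) :
    ∃ ε > 0, ∃ N ∈ 𝓝 ((μ₀, σ₀) : Param m), ∀ Y ∈ Icc (-1 : ℝ) 1, ∀ v ∈ Icc (0 : ℝ) 1,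
      ∀ a : ℝ, |a| < ε → ∀ P ∈ N, Q (Y, a, v, P) := by
  have h1 : ∀ᶠ z in 𝓝 ((0, (μ₀, σ₀)) : ℝ × Param m),
      ∀ y ∈ Icc (-1 : ℝ) 1 ×ˢ Icc (0 : ℝ) 1, Q (y.1, z.1, y.2, z.2) := by
    refine (isCompact_Icc.prod isCompact_Icc).eventually_forall_of_forall_eventually fun y _ => ?_
    have hc : ContinuousAt (fun w : (ℝ × Param m) × (ℝ × ℝ) => (w.2.1, w.1.1, w.2.2, w.1.2))
      ((0, (μ₀, σ₀)), y) := by fun_prop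
    exact hc.eventually (h y.1 y.2)
  rw [nhds_prod_eq, eventually_prod_iff] at h1
  obtain ⟨pa, hpa, pb, hpb, H⟩ := h1
  obtain ⟨ε, hε, h2⟩ := Metric.eventually_nhds_iff.1 hpa
  refine ⟨ε, hε, {P | pb P}, hpb, fun Y hY v hv a ha P hP => ?_⟩
  exact H (h2 (by simpa using ha)) hP (Y, v) ⟨hY, hv⟩

lemma root_scaling {u u₀ : ℝ} (hu : 0 < u) (hu₀ : 0 < u₀) {l : ℕ} (hl : l ≠ 0) :
    0 < (u / u₀) ^ (1 / (l : ℝ)) ∧ u₀ * ((u / u₀) ^ (1 / (l : ℝ))) ^ l = u := by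
  refine ⟨by positivity, ?_⟩
  rw [← Real.rpow_natCast, ← Real.rpow_mul (by positivity),
    one_div_mul_cancel (by exact_mod_cast hl), Real.rpow_one]
  field_simp

lemma root_lt {u u₀ ε : ℝ} (hu : 0 < u) (hu₀ : 0 < u₀) (hε : 0 < ε) {l : ℕ} (hl : l ≠ 0)
    (h : u < u₀ * ε ^ l) : |(u / u₀) ^ (1 / (l : ℝ))| < ε := by
  obtain ⟨h1, h2⟩ := root_scaling hu hu₀ hl
  rw [abs_of_pos h1]
  refine lt_of_pow_lt_pow_left₀ l hε.le ?_
  rw [← h2] at h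
  exact lt_of_mul_lt_mul_left h hu₀.le

/-- A region on which the remainder exists and all quantities that enter the transition map are
controlled. -/
structure IsUniformRegion (p q K : ℕ) (σ₀ u₀ Y₀ B u₁ : ℝ) (L : Set (Param m)) (φ : Param m → ℝ[X])
    (Φ : Param m → MvPolynomial (Fin 2) ℝ) (η : Param m → ℝ[X]) (N : Set (Param m)) : Prop where
  pos : 0 < u₁
  lt : u₁ < u₀
  le_half : u₁ ≤ 1 / 2
  nonneg : 0 ≤ B
  subset : N ⊆ L
  coeff_le : ∀ P ∈ N, ∀ i j, i ≤ K → j < K → |coeffSucc (Φ P) i j| ≤ B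
  one_le_time : ∀ u ∈ Ioo 0 u₁, 1 ≤ Real.log (u₀ / u)
  alpha_le : ∀ P ∈ N, ∀ u ∈ Ioo 0 u₁, ∀ v ∈ Ico (0 : ℝ) 1,
    |alpha σ₀ φ P (u * v)| ≤ 1 ∧ q * |alpha σ₀ φ P (u * v)| ≤ 1 / 2
  eta_le : ∀ P ∈ N, ∀ u ∈ Ioo 0 u₁, ∀ v ∈ Ico (0 : ℝ) 1, |v ^ p * (η P).eval (u * v)| ≤ B
  landing : ∀ P ∈ N, ∀ u ∈ Ioo 0 u₁, ∀ v ∈ Ico (0 : ℝ) 1,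
    Real.exp (-(sigmaBar φ P (u * v) * Real.log (u₀ / u)))
      * ((2 + B) * (1 + expInt (alpha σ₀ φ P (u * v)) (Real.log (u₀ / u)))) ≤ Y₀
  exists_remainder : ∀ P ∈ N, ∀ u ∈ Ioo 0 u₁, ∀ v ∈ Ico (0 : ℝ) 1, ∀ Y ∈ Ioo (-1 : ℝ) 1,
    ∃ R, IsRemainder p q K σ₀ u₀ φ Φ η P Y u v R ∧ ‖R‖ ≤ 1

/-- The prefactor decays at least at rate 3σ₀/4, while the integral is at most T e^(σ₀T/4); the
cruder rate σ₀/4 is enough. -/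
lemma exists_landing_time {σ₀ B Y₀ : ℝ} (hσ₀ : 0 < σ₀) (hB : 0 ≤ B) (hY₀ : 0 < Y₀) :
    ∃ T₀ : ℝ, 1 ≤ T₀ ∧ ∀ T, T₀ ≤ T → ∀ α, |α| ≤ σ₀ / 4 →
      Real.exp (-((σ₀ + α) * T)) * ((2 + B) * (1 + expInt α T)) ≤ Y₀ := by
  have h1 : Tendsto (fun T : ℝ => (2 + B) * (T ^ 0 * Real.exp (-(σ₀ / 4) * T)
      + T ^ 1 * Real.exp (-(σ₀ / 4) * T))) atTop (𝓝 ((2 + B) * (0 + 0))) := by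
    have h : ∀ n : ℕ, Tendsto (fun T : ℝ => T ^ n * Real.exp (-(σ₀ / 4) * T)) atTop (𝓝 0) := by
      intro n
      have := tendsto_rpow_mul_exp_neg_mul_atTop_nhds_zero (n : ℝ) (σ₀ / 4) (by positivity)
      simpa only [Real.rpow_natCast] using this
    exact ((h 0).add (h 1)).const_mul _
  have h2 := h1.eventually_le_const (show (2 + B) * (0 + 0) < Y₀ by simpa using hY₀)
  obtain ⟨T₁, hT₁⟩ := eventually_atTop.1 h2
  refine ⟨max T₁ 1, le_max_right _ _, fun T hT α hα => ?_⟩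
  have hT1 : 1 ≤ T := (le_max_right _ _).trans hT
  refine le_trans ?_ (hT₁ T ((le_max_left _ _).trans hT))
  have h3 : Real.exp (-((σ₀ + α) * T)) ≤ Real.exp (-(σ₀ / 4) * T) := by
    rw [Real.exp_le_exp]
    nlinarith [(abs_le.1 hα).1]
  have h4 : Real.exp (-((σ₀ + α) * T)) * Real.exp (|α| * T) ≤ Real.exp (-(σ₀ / 4) * T) := by
    rw [← Real.exp_add, Real.exp_le_exp]
    nlinarith [(abs_le.1 hα).1]
  have h5 := expInt_le (α := α) (by linarith : 0 ≤ T)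
  calc Real.exp (-((σ₀ + α) * T)) * ((2 + B) * (1 + expInt α T))
      ≤ Real.exp (-((σ₀ + α) * T)) * ((2 + B) * (1 + T * Real.exp (|α| * T))) := by gcongr
    _ = (2 + B) * (Real.exp (-((σ₀ + α) * T))
          + T * (Real.exp (-((σ₀ + α) * T)) * Real.exp (|α| * T))) := by ring
    _ ≤ (2 + B) * (Real.exp (-(σ₀ / 4) * T) + T * Real.exp (-(σ₀ / 4) * T)) := by gcongr
    _ = _ := by ring

/-- Uniform control of a continuous function of `(P, ν)` near `(P₀, 0)`. -/
lemma exists_nhds_of_eventually {P₀ : Param m} {Q : Param m → ℝ → Prop}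
    (h : ∀ᶠ z in 𝓝 ((P₀, 0) : Param m × ℝ), Q z.1 z.2) :
    ∃ ε > 0, ∃ N ∈ 𝓝 P₀, ∀ P ∈ N, ∀ ν : ℝ, |ν| < ε → Q P ν := by
  rw [nhds_prod_eq, eventually_prod_iff] at h
  obtain ⟨pa, hpa, pb, hpb, H⟩ := h
  obtain ⟨ε, hε, h2⟩ := Metric.eventually_nhds_iff.1 hpb
  exact ⟨ε, hε, {P | pa P}, hpa, fun P hP ν hν => H hP (h2 (by simpa using hν))⟩

lemma DulacSaddle.IsSmoothPolyFamily.continuousAt_eval {L : Set (Param m)} {K : ℕ}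
    {f : Param m → ℝ[X]} (hf : IsSmoothPolyFamily L K f) (hL : IsOpen L) {P₀ : Param m}
    (hP₀ : P₀ ∈ L) : ContinuousAt (fun z : Param m × ℝ => (f z.1).eval z.2) (P₀, 0) :=
  (hf.contDiffAt_eval (n := 0) hL (P := fun z : Param m × ℝ => z.1) (ν := fun z => z.2)
    contDiffAt_fst contDiffAt_snd hP₀).continuousAt

lemma exists_nhds_alpha_le {L : Set (Param m)} {K : ℕ} {φ : Param m → ℝ[X]}
    {μ₀ : EuclideanSpace ℝ (Fin m)} {σ₀ : ℝ} (hφ : IsSmoothPolyFamily L K φ) (hL : IsOpen L)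
    (hL₀ : (μ₀, σ₀) ∈ L) (h0 : (φ (μ₀, σ₀)).eval 0 = 0) {δ : ℝ} (hδ : 0 < δ) :
    ∃ ε > 0, ∃ N ∈ 𝓝 ((μ₀, σ₀) : Param m), ∀ P ∈ N, ∀ ν : ℝ, |ν| < ε → |alpha σ₀ φ P ν| ≤ δ := by
  refine exists_nhds_of_eventually ?_
  have hc : ContinuousAt (fun z : Param m × ℝ => |alpha σ₀ φ z.1 z.2|) ((μ₀, σ₀), 0) :=
    (((continuous_snd.comp continuous_fst).continuousAt.add
      (hφ.continuousAt_eval hL hL₀)).sub continuousAt_const).abs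
  exact hc.eventually_le_const (by simpa [alpha, sigmaBar, h0] using hδ)

lemma exists_isUniformRegion {p q K : ℕ} {σ₀ u₀ Y₀ : ℝ} {μ₀ : EuclideanSpace ℝ (Fin m)}
    {L : Set (Param m)} (hL : IsOpen L) (hL₀ : (μ₀, σ₀) ∈ L) {φ : Param m → ℝ[X]}
    {Φ : Param m → MvPolynomial (Fin 2) ℝ} {η : Param m → ℝ[X]} (hp : 0 < p) (hq : 0 < q)
    (hσ : 0 < σ₀) (hσ₀ : σ₀ = (p : ℝ) / q) (hu₀ : 0 < u₀) (hY₀ : 0 < Y₀)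
    (h : IsResonantFamily q L K φ Φ η) :
    ∃ B u₁ : ℝ, ∃ N ∈ 𝓝 ((μ₀, σ₀) : Param m), IsUniformRegion p q K σ₀ u₀ Y₀ B u₁ L φ Φ η N := by
  set P₀ : Param m := (μ₀, σ₀) with hP₀
  -- The three entries serve q|α| ≤ 1/2, |α| ≤ 1 and the landing condition.
  set δ := min (1 / (2 * (q : ℝ))) (min 1 (σ₀ / 4)) with hδ
  have hq0 : (0 : ℝ) < q := by exact_mod_cast hq
  have hδ0 : 0 < δ := by positivity
  obtain ⟨ε₁, hε₁, N₁, hN₁, H₁⟩ :=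
    exists_nhds_alpha_le h.smooth_phi hL hL₀ (h.phi_zero _ hL₀) hδ0
  obtain ⟨ε₂, hε₂, N₂, hN₂, H₂⟩ := exists_nhds_of_eventually (P₀ := P₀)
    (Q := fun P ν => |(η P).eval ν| ≤ |(η P₀).eval 0| + 1)
    ((h.smooth_eta.continuousAt_eval hL hL₀).abs.eventually_le_const (lt_add_one _))
  -- Only existence and ‖R‖ ≤ 1 are needed here, so the least admissible pair l = 2, n = 1 is used.
  obtain ⟨ε₃, hε₃, N₃, hN₃, H₃⟩ := eventually_uniform fun Y v =>
    (contDiffAt_remainderExt (u₀ := u₀) (l := 2) (n := 1) hu₀ hL hL₀ hp hq hσ₀ h one_ne_zero le_rfl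
      Y v).2
  have H₄ : ∀ᶠ P in 𝓝 P₀, ∀ i ∈ Finset.range (K + 1), ∀ j ∈ Finset.range K,
      |coeffSucc (Φ P) i j| ≤ |coeffSucc (Φ P₀) i j| + 1 := by
    rw [Filter.eventually_all_finset]
    intro i _
    rw [Filter.eventually_all_finset]
    intro j _
    have hc := ((h.smooth_Phi.2 (Finsupp.single 0 i + Finsupp.single 1 (j + 1))).continuousOn
      |>.continuousAt (hL.mem_nhds hL₀)).abs
    exact hc.eventually_le_const (lt_add_one _)
  set B := |(η P₀).eval 0| + 1 + ∑ i ∈ Finset.range (K + 1), ∑ j ∈ Finset.range K,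
    (|coeffSucc (Φ P₀) i j| + 1) with hB
  have hsum0 : 0 ≤ ∑ i ∈ Finset.range (K + 1), ∑ j ∈ Finset.range K,
      (|coeffSucc (Φ P₀) i j| + 1) :=
    Finset.sum_nonneg fun i _ => Finset.sum_nonneg fun j _ => by positivity
  have hB0 : 0 ≤ B := by positivity
  obtain ⟨T₀, hT₀, HT⟩ := exists_landing_time hσ hB0 hY₀
  -- In order: |log u| ≥ log 2, ν small enough for the bounds on α and η, a = (u/u₀)^(1/2) below ε₃,
  -- and flight time at least T₀.
  set u₁ := min (min (1 / 2) (min ε₁ ε₂)) (min (u₀ * ε₃ ^ 2) (u₀ * Real.exp (-T₀))) with hu₁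
  have hu₁0 : 0 < u₁ := by positivity
  have hu1half : u₁ ≤ 1 / 2 := (min_le_left _ _).trans (min_le_left _ _)
  have hu1ε₁ : u₁ ≤ ε₁ := (min_le_left _ _).trans ((min_le_right _ _).trans (min_le_left _ _))
  have hu1ε₂ : u₁ ≤ ε₂ := (min_le_left _ _).trans ((min_le_right _ _).trans (min_le_right _ _))
  have hu1ε₃ : u₁ ≤ u₀ * ε₃ ^ 2 := (min_le_right _ _).trans (min_le_left _ _)
  have hu1T : u₁ ≤ u₀ * Real.exp (-T₀) := (min_le_right _ _).trans (min_le_right _ _)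
  have huv : ∀ u ∈ Ioo 0 u₁, ∀ v ∈ Ico (0 : ℝ) 1, |u * v| < u₁ := fun u hu v hv => by
    rw [abs_of_nonneg (mul_nonneg hu.1.le hv.1)]
    exact (mul_le_of_le_one_right hu.1.le hv.2.le).trans_lt hu.2
  have htime : ∀ u ∈ Ioo 0 u₁, T₀ ≤ Real.log (u₀ / u) := fun u hu => by
    rw [Real.le_log_iff_exp_le (div_pos hu₀ hu.1), le_div_iff₀ hu.1]
    have h1 := (hu.2.le.trans hu1T)
    calc Real.exp T₀ * u ≤ Real.exp T₀ * (u₀ * Real.exp (-T₀)) := by gcongr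
      _ = u₀ := by rw [Real.exp_neg]; field_simp
  have halpha : ∀ P ∈ N₁, ∀ u ∈ Ioo 0 u₁, ∀ v ∈ Ico (0 : ℝ) 1,
      |alpha σ₀ φ P (u * v)| ≤ δ := fun P hP u hu v hv =>
    H₁ P hP _ ((huv u hu v hv).trans_le hu1ε₁)
  refine ⟨B, u₁, N₁ ∩ N₂ ∩ N₃ ∩ {P | ∀ i ∈ Finset.range (K + 1), ∀ j ∈ Finset.range K,
      |coeffSucc (Φ P) i j| ≤ |coeffSucc (Φ P₀) i j| + 1} ∩ L,
    inter_mem (inter_mem (inter_mem (inter_mem hN₁ hN₂) hN₃) H₄) (hL.mem_nhds hL₀), ?_⟩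
  refine ⟨hu₁0, ?_, hu1half, hB0, inter_subset_right, ?_, fun u hu => hT₀.trans (htime u hu), ?_, ?_,
    ?_, ?_⟩
  · refine hu1T.trans_lt (mul_lt_of_lt_one_right hu₀ (Real.exp_lt_one_iff.2 (by linarith)))
  · rintro P ⟨⟨-, hP⟩, -⟩ i j hi hj
    have hi' := Finset.mem_range.2 (Nat.lt_succ_of_le hi)
    have hj' := Finset.mem_range.2 hj
    refine (hP i hi' j hj').trans ?_
    have h1 : |coeffSucc (Φ P₀) i j| + 1
        ≤ ∑ j ∈ Finset.range K, (|coeffSucc (Φ P₀) i j| + 1) :=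
      Finset.single_le_sum (f := fun j => |coeffSucc (Φ P₀) i j| + 1)
        (fun j _ => by positivity) hj'
    have h2 := Finset.single_le_sum (f := fun i => ∑ j ∈ Finset.range K,
      (|coeffSucc (Φ P₀) i j| + 1)) (fun i _ => Finset.sum_nonneg fun j _ => by positivity) hi'
    have h3 : 0 ≤ |(η P₀).eval 0| := abs_nonneg _
    linarith
  · rintro P ⟨⟨⟨⟨hP, -⟩, -⟩, -⟩, -⟩ u hu v hv
    have h1 := halpha P hP u hu v hv
    refine ⟨h1.trans ((min_le_right _ _).trans (min_le_left _ _)), ?_⟩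
    have h2 := mul_le_mul_of_nonneg_left (h1.trans (min_le_left _ _)) hq0.le
    refine h2.trans (le_of_eq ?_)
    field_simp
  · rintro P ⟨⟨⟨⟨-, hP⟩, -⟩, -⟩, -⟩ u hu v hv
    have h1 := H₂ P hP _ ((huv u hu v hv).trans_le hu1ε₂)
    rw [abs_mul, abs_pow, abs_of_nonneg hv.1]
    refine (mul_le_of_le_one_left (abs_nonneg _) (pow_le_one₀ hv.1 hv.2.le)).trans ?_
    linarith
  · rintro P ⟨⟨⟨⟨hP, -⟩, -⟩, -⟩, -⟩ u hu v hv
    have h1 := (halpha P hP u hu v hv).trans ((min_le_right _ _).trans (min_le_right _ _))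
    have h2 := HT _ (htime u hu) _ h1
    have h3 : σ₀ + alpha σ₀ φ P (u * v) = sigmaBar φ P (u * v) := by rw [alpha]; ring
    rwa [h3] at h2
  · rintro P ⟨⟨⟨-, hP⟩, -⟩, -⟩ u hu v hv Y hY
    obtain ⟨h1, h2⟩ := root_scaling hu.1 hu₀ (two_ne_zero (α := ℕ))
    have h3 := H₃ Y (Ioo_subset_Icc_self hY) v (Ico_subset_Icc_self hv) _
      (root_lt hu.1 hu₀ hε₃ two_ne_zero (hu.2.trans_le hu1ε₃)) P hP h1
    simp only [h2] at h3
    exact h3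

variable {p q K : ℕ} {σ₀ u₀ Y₀ B u₁ : ℝ} {L N : Set (Param m)} {φ : Param m → ℝ[X]}
  {Φ : Param m → MvPolynomial (Fin 2) ℝ} {η : Param m → ℝ[X]}

lemma exp_neg_mul_log_div {u : ℝ} (hu : 0 < u) (hu₀ : 0 < u₀) (σ : ℝ) :
    Real.exp (-(σ * Real.log (u₀ / u))) = (u / u₀) ^ σ := by
  rw [Real.rpow_def_of_pos (div_pos hu hu₀), ← inv_div, Real.log_inv]
  ring_nf

lemma compensator_div {u : ℝ} (hu : 0 < u) (hu₀ : 0 < u₀) (α : ℝ) :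
    compensator (u / u₀) α = expInt α (Real.log (u₀ / u)) := by
  rw [compensator_eq_expInt (div_pos hu hu₀), ← Real.log_inv, inv_div]

lemma IsUniformRegion.hasTransition (hR : IsUniformRegion p q K σ₀ u₀ Y₀ B u₁ L φ Φ η N)
    (hq : 0 < q) (hσ₀ : σ₀ = (p : ℝ) / q) (h : IsResonantFamily q L K φ Φ η) {v₀ : ℝ} {P : Param m}
    (hP : P ∈ N) {u v Y : ℝ} (hu : u ∈ Ioo 0 u₁) (hv : v ∈ Ico (0 : ℝ) 1) (hvv : v ≤ v₀)
    (hY : Y ∈ Ioo (-1 : ℝ) 1) :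
    HasTransition (resonantField p q φ Φ η P) u₀ v₀ Y₀ u v Y
      ((η P).eval (u * v) * v ^ p * (u / u₀) ^ (sigmaBar φ P (u * v))
          * compensator (u / u₀) (alpha σ₀ φ P (u * v))
        + (u / u₀) ^ (sigmaBar φ P (u * v))
          * (Y + transRemainder p q K σ₀ u₀ φ Φ η P Y u v)) := by
  obtain ⟨R, hR1, hR2⟩ := hR.exists_remainder P hP u hu v hv Y hY
  have huu : u < u₀ := hu.2.trans hR.lt
  have hu₀ : 0 < u₀ := hu.1.trans huu
  have hT : 1 ≤ Real.log (u₀ / u) := hR.one_le_time u hu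
  have hT0 : 0 < Real.log (u₀ / u) := by linarith
  have hend := fiberCurve_end (sigmaBar φ P (u * v)) (alpha σ₀ φ P (u * v))
    (v ^ p * (η P).eval (u * v)) Y hT0.ne' R
  have hland : |fiberCurve (sigmaBar φ P (u * v)) (Real.log (u₀ / u)) (alpha σ₀ φ P (u * v))
      (v ^ p * (η P).eval (u * v)) Y R (Real.log (u₀ / u))| ≤ Y₀ := by
    rw [hend, abs_mul, Real.abs_exp]
    refine le_trans ?_ (hR.landing P hP u hu v hv)
    refine mul_le_mul_of_nonneg_left ?_ (Real.exp_pos _).le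
    have h1 := abs_fiber_le (α := alpha σ₀ φ P (u * v)) hT0.le (hR.eta_le P hP u hu v hv)
      (abs_le.2 ⟨hY.1.le, hY.2.le⟩) hR2 1
    simpa using h1
  have key := (hR1.isFiberSolution hq hσ₀ h (hR.subset hP) hu.1 huu).hasTransition
    (contDiff_resonantField _ _ _ _ _ _) (fun _ => rfl) (fun _ => rfl) hu.1 huu hv.1 hvv hland
  rw [fiberCurve_zero _ _ _ _ _ hR1.apply_zero, hend, exp_neg_mul_log_div hu.1 hu₀, compFun_apply]
    at key
  convert key using 1
  rw [hR1.transRemainder_eq hq hσ₀ h (hR.subset hP) hu.1 huu, compensator_div hu.1 hu₀,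
    Set.Icc.coe_one, mul_one]
  ring

/-- The pointwise bound is in terms of T and e^(-qαT). These are compared with |log u| and u^(qα) at
the cost of constants depending on u₀; u ≤ 1/2 keeps |log u| away from 0. -/
lemma IsUniformRegion.exists_bound (hR : IsUniformRegion p q K σ₀ u₀ Y₀ B u₁ L φ Φ η N)
    (hp : 0 < p) (hq : 0 < q) (hσ₀ : σ₀ = (p : ℝ) / q) (h : IsResonantFamily q L K φ Φ η) :
    ∃ C : ℝ, 0 ≤ C ∧ ∀ P ∈ N, ∀ u ∈ Ioo 0 u₁, ∀ v ∈ Ico (0 : ℝ) 1, ∀ Y ∈ Ioo (-1 : ℝ) 1,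
      |transRemainder p q K σ₀ u₀ φ Φ η P Y u v| ≤
        C * (u ^ ((p : ℝ) + q * alpha σ₀ φ P (u * v))
          * compensator (u / u₀) (alpha σ₀ φ P (u * v)) ^ (q + 1) * |Real.log u|) := by
  have hu₀ : 0 < u₀ := hR.pos.trans hR.lt
  set M := u₀ ^ p * (2 ^ q * (q.factorial : ℝ)) with hM
  set C₁ := (K + 1) * B * (∑ j ∈ Finset.range K, ((2 + B) * (Real.exp 1 + 1)) ^ (q * j) * M ^ j)
    * ((2 + B) * (Real.exp 1 + 1)) ^ (q + 1) with hC₁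
  have hB := hR.nonneg
  have hC₁0 : 0 ≤ C₁ := by
    have : 0 ≤ ∑ j ∈ Finset.range K, ((2 + B) * (Real.exp 1 + 1)) ^ (q * j) * M ^ j :=
      Finset.sum_nonneg fun j _ => by positivity
    positivity
  have hlog2 : 0 < Real.log 2 := Real.log_pos one_lt_two
  refine ⟨C₁ * ((|Real.log u₀| / Real.log 2 + 1) * Real.exp |Real.log u₀|), by positivity, ?_⟩
  intro P hP u hu v hv Y hY
  obtain ⟨R, hR1, hR2⟩ := hR.exists_remainder P hP u hu v hv Y hY
  have huu : u < u₀ := hu.2.trans hR.lt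
  rw [hR1.transRemainder_eq hq hσ₀ h (hR.subset hP) hu.1 huu, compensator_div hu.1 hu₀]
  obtain ⟨hα1, hα2⟩ := hR.alpha_le P hP u hu v hv
  set α := alpha σ₀ φ P (u * v) with hα
  set T := Real.log (u₀ / u) with hT
  have hT1 : 1 ≤ T := hR.one_le_time u hu
  have hT0 : 0 ≤ T := by linarith
  have hν : |u * v| ≤ 1 := by
    rw [abs_of_nonneg (mul_nonneg hu.1.le hv.1)]
    exact mul_le_one₀ (by linarith [hu.2, hR.le_half]) hv.1 hv.2.le
  have huT : u = u₀ * Real.exp (-T) := by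
    rw [hT, ← Real.log_inv, inv_div, Real.exp_log (div_pos hu.1 hu₀)]
    field_simp
  have hMle : u ^ p * (Real.exp (-(α * T)) * expInt α T) ^ q ≤ M := by
    conv_lhs => rw [huT]
    exact pow_mul_exp_expInt_le hp hu₀ hT0 hα2
  have h1 : |R 1| ≤ C₁ * (T * (u ^ p * Real.exp (-(q * α * T)) * expInt α T ^ (q + 1))) := by
    have h2 := abs_volterra_le _ (abs_remainderField_le (c := coeffSucc (Φ P)) (κ := v ^ p * (η P).eval (u * v))
      (pow_nonneg hu.1.le p) hT1 hα1 hν (hR.coeff_le P hP) hB (hR.eta_le P hP u hu v hv)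
      (abs_le.2 ⟨hY.1.le, hY.2.le⟩) hR2 hMle) 1
    rw [IsRemainder] at hR1
    rw [← hR1] at h2
    exact h2
  have hlu : Real.log 2 ≤ |Real.log u| := by
    have h3 : Real.log u ≤ Real.log (1 / 2) :=
      Real.log_le_log hu.1 (hu.2.le.trans hR.le_half)
    rw [one_div, Real.log_inv] at h3
    rw [abs_of_neg (by linarith)]
    linarith
  have hTle : T ≤ (|Real.log u₀| / Real.log 2 + 1) * |Real.log u| := by
    rw [hT, Real.log_div hu₀.ne' hu.1.ne', add_mul, one_mul]
    have h3 : |Real.log u₀| ≤ |Real.log u₀| / Real.log 2 * |Real.log u| := by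
      rw [div_mul_eq_mul_div, le_div_iff₀ hlog2]
      exact mul_le_mul_of_nonneg_left hlu (abs_nonneg _)
    linarith [le_abs_self (Real.log u₀), neg_abs_le (Real.log u)]
  have hexp : Real.exp (-(q * α * T)) ≤ Real.exp |Real.log u₀| * u ^ (q * α) := by
    rw [Real.rpow_def_of_pos hu.1, ← Real.exp_add, Real.exp_le_exp, hT,
      Real.log_div hu₀.ne' hu.1.ne']
    have h3 : |q * α * Real.log u₀| ≤ |Real.log u₀| := by
      rw [abs_mul, abs_mul, Nat.abs_cast]
      exact mul_le_of_le_one_left (abs_nonneg _) (by linarith)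
    linarith [neg_abs_le (q * α * Real.log u₀)]
  have hw0 : 0 ≤ expInt α T := expInt_nonneg hT0
  clear_value C₁ T
  refine h1.trans ?_
  rw [Real.rpow_add hu.1, Real.rpow_natCast]
  have hup : 0 ≤ u ^ p := pow_nonneg hu.1.le p
  have huq : 0 ≤ u ^ (q * α) := Real.rpow_nonneg hu.1.le _
  calc C₁ * (T * (u ^ p * Real.exp (-(q * α * T)) * expInt α T ^ (q + 1)))
      ≤ C₁ * (((|Real.log u₀| / Real.log 2 + 1) * |Real.log u|)
        * (u ^ p * (Real.exp |Real.log u₀| * u ^ (q * α)) * expInt α T ^ (q + 1))) := by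
        gcongr
    _ = _ := by ring

end UniformRegion

/-! ### The linear case -/

section Nonresonant

variable {m : ℕ}

/-- The condition σ̄ ≥ 0 keeps |Y| from growing, so the landing point satisfies |Y| ≤ Y₀. -/
lemma hasTransition_nonresonantField (φ : Param m → ℝ[X]) (P : Param m) {u₀ v₀ Y₀ u v Y : ℝ}
    (hu : 0 < u) (huu : u < u₀) (hv : 0 ≤ v) (hvv : v ≤ v₀) (hY : |Y| ≤ Y₀)
    (hσ : 0 ≤ sigmaBar φ P (u * v)) :
    HasTransition (nonresonantField φ P) u₀ v₀ Y₀ u v Y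
      ((u / u₀) ^ (sigmaBar φ P (u * v)) * Y) := by
  have hu₀ : 0 < u₀ := hu.trans huu
  have hX : ContDiff ℝ 1 (nonresonantField φ P) := by
    rw [nonresonantField_eq]
    exact contDiff_resonantField _ _ _ _ _ _
  set S := sigmaBar φ P (u * v) with hS
  have hy : IsFiberSolution (nonresonantField φ P) u v (Real.log (u₀ / u))
      (fun t => Real.exp (-(S * t)) * Y) := by
    intro t _
    have hν : u * Real.exp t * (v * Real.exp (-t)) = u * v := by
      rw [Real.exp_neg]; field_simp
    have hd : HasDerivAt (fun t => Real.exp (-(S * t)) * Y) (Real.exp (-(S * t)) * -(S * 1) * Y) t :=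
      (((hasDerivAt_id t).const_mul S).neg.exp).mul_const Y
    refine (hd.congr_deriv ?_).hasDerivWithinAt
    simp only [nonresonantField, hν, ← hS]
    ring
  have hle : (u / u₀) ^ S ≤ 1 :=
    Real.rpow_le_one (div_nonneg hu.le hu₀.le) ((div_le_one hu₀).2 huu.le) hσ
  have key := hy.hasTransition (v₀ := v₀) (Y₀ := Y₀) hX (fun _ => rfl) (fun _ => rfl) hu huu hv hvv
    (by
      rw [exp_neg_mul_log_div hu hu₀, abs_mul, abs_of_nonneg (Real.rpow_nonneg (by positivity) _)]
      exact (mul_le_of_le_one_left (abs_nonneg _) hle).trans hY)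
  simp only [exp_neg_mul_log_div hu hu₀, mul_zero, neg_zero, Real.exp_zero, one_mul] at key
  exact key

end Nonresonant

/-! ### Class C^(l-2) in the stated variables, and restriction to sections -/

section SmoothnessInVariables

variable {m : ℕ} {p q K : ℕ} {σ₀ u₀ Y₀ B u₁ : ℝ} {L N : Set (Param m)} {φ : Param m → ℝ[X]}
  {Φ : Param m → MvPolynomial (Fin 2) ℝ} {η : Param m → ℝ[X]} {μ₀ : EuclideanSpace ℝ (Fin m)}

lemma IsUniformRegion.exists_smooth_region
    (hR : IsUniformRegion p q K σ₀ u₀ Y₀ B u₁ L φ Φ η N) (hN : N ∈ 𝓝 ((μ₀, σ₀) : Param m))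
    (hL : IsOpen L) (hL₀ : (μ₀, σ₀) ∈ L) (hp : 0 < p) (hq : 0 < q) (hσ₀ : σ₀ = (p : ℝ) / q)
    (h : IsResonantFamily q L K φ Φ η) {l : ℕ} (hl : 2 ≤ l) :
    ∃ W : Set (ℝ × ℝ × ℝ × Param m), IsOpen W ∧ (∀ Y v, (Y, 0, v, (μ₀, σ₀)) ∈ W) ∧
      ContDiffOn ℝ (l - 2 : ℕ) (remainderExt p q K l σ₀ u₀ φ Φ η) W ∧
      ∃ u₂ ∈ Ioc 0 u₁, ∃ N₂ ∈ 𝓝 ((μ₀, σ₀) : Param m), N₂ ⊆ N ∧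
        ∀ P ∈ N₂, ∀ u ∈ Ioo 0 u₂, ∀ v ∈ Ico (0 : ℝ) 1, ∀ Y ∈ Ioo (-1 : ℝ) 1,
          (Y, (u / u₀) ^ (1 / (l : ℝ)), v, P) ∈ W ∧ transRemainder p q K σ₀ u₀ φ Φ η P Y u v
            = remainderExt p q K l σ₀ u₀ φ Φ η (Y, (u / u₀) ^ (1 / (l : ℝ)), v, P) := by
  have hu₀ : 0 < u₀ := hR.pos.trans hR.lt
  have hl0 : l ≠ 0 := by omega
  -- The class C^(l-1) is available and of order at least 1, which the implicit function theorem
  -- needs even for l = 2, where only continuity is claimed.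
  have hsm : ∀ Y v, ContDiffAt ℝ (l - 1 : ℕ) (remainderExt p q K l σ₀ u₀ φ Φ η)
      (Y, 0, v, (μ₀, σ₀)) := fun Y v =>
    (contDiffAt_remainderExt hu₀ hL hL₀ hp hq hσ₀ h (by omega) (by omega) Y v).1
  have hopen : IsOpen {x | ContDiffAt ℝ (l - 1 : ℕ) (remainderExt p q K l σ₀ u₀ φ Φ η) x} :=
    isOpen_iff_mem_nhds.2 fun x hx => ContDiffAt.eventually hx (by simp)
  obtain ⟨ε, hε, N', hN', H⟩ := eventually_uniform fun Y v => hopen.mem_nhds (hsm Y v)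
  refine ⟨_, hopen, hsm, fun x hx => ?_, min u₁ (u₀ * ε ^ l),
    ⟨lt_min hR.pos (by positivity), min_le_left _ _⟩, N' ∩ N, inter_mem hN' hN, inter_subset_right, ?_⟩
  · have hle : ((l - 2 : ℕ) : ℕ∞ω) ≤ (l - 1 : ℕ) := by exact_mod_cast (by omega : l - 2 ≤ l - 1)
    have hx' : ContDiffAt ℝ (l - 1 : ℕ) (remainderExt p q K l σ₀ u₀ φ Φ η) x := hx
    exact (hx'.of_le hle).contDiffWithinAt
  · rintro P ⟨hP, -⟩ u hu v hv Y hY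
    obtain ⟨h1, h2⟩ := root_scaling hu.1 hu₀ hl0
    refine ⟨H Y (Ioo_subset_Icc_self hY) v (Ico_subset_Icc_self hv) _
      (root_lt hu.1 hu₀ hε hl0 (hu.2.trans_le (min_le_right _ _))) P hP, ?_⟩
    rw [remainderExt, if_pos h1]
    simp only [h2]

lemma isCkInVariables_of_comp {A F G : Type*} [NormedAddCommGroup F] [NormedSpace ℝ F]
    [NormedAddCommGroup G] [NormedSpace ℝ G] {n : ℕ} {f : A → ℝ} {M : A → F} {D : Set A} {S : Set F}
    {e : G → ℝ} {W : Set G} (hW : IsOpen W) (he : ContDiffOn ℝ n e W) {θ : F → G}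
    (hθ : ContDiff ℝ n θ) (hS : ∀ x ∈ S, θ x ∈ W) (hD : ∀ a ∈ D, θ (M a) ∈ W ∧ f a = e (θ (M a))) :
    IsCkInVariables n f M D S :=
  ⟨θ ⁻¹' W, hW.preimage hθ.continuous, hS, fun a ha => (hD a ha).1, e ∘ θ,
    he.comp hθ.contDiffOn (fun _ hx => hx), fun a ha => (hD a ha).2⟩

lemma compensator_nonneg {ξ : ℝ} (hξ : 0 < ξ) (hξ1 : ξ ≤ 1) (α : ℝ) : 0 ≤ compensator ξ α := by
  rw [compensator_eq_expInt hξ]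
  exact expInt_nonneg (neg_nonneg.2 (Real.log_nonpos hξ.le hξ1))

/-- Setting u = ν/ρ₀ costs the factor ρ₀^(-(p+qα)) ≤ ρ₀^(-(p+1)) in the power, and a constant factor
in the logarithm because |log ν| ≥ log 2. -/
lemma IsUniformRegion.exists_bound_section
    (hR : IsUniformRegion p q K σ₀ u₀ Y₀ B u₁ L φ Φ η N)
    (hp : 0 < p) (hq : 0 < q) (hσ₀ : σ₀ = (p : ℝ) / q) (h : IsResonantFamily q L K φ Φ η) {ρ₀ : ℝ}
    (hρ : ρ₀ ∈ Ioo (0 : ℝ) 1) :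
    ∃ C : ℝ, ∀ P ∈ N, ∀ ν ∈ Ioo 0 (u₁ * ρ₀), ∀ Y ∈ Ioo (-1 : ℝ) 1,
      |transRemainder p q K σ₀ u₀ φ Φ η P Y (ν / ρ₀) ρ₀| ≤ C * (ν ^ ((p : ℝ) + q * alpha σ₀ φ P ν)
        * compensator (ν / (u₀ * ρ₀)) (alpha σ₀ φ P ν) ^ (q + 1) * |Real.log ν|) := by
  obtain ⟨C, hC0, hC⟩ := hR.exists_bound hp hq hσ₀ h
  have hu₀ : 0 < u₀ := hR.pos.trans hR.lt
  have hlog2 : 0 < Real.log 2 := Real.log_pos one_lt_two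
  refine ⟨C * (ρ₀ ^ (-((p : ℝ) + 1)) * (1 + |Real.log ρ₀| / Real.log 2)), fun P hP ν hν Y hY => ?_⟩
  have hu : ν / ρ₀ ∈ Ioo 0 u₁ := ⟨div_pos hν.1 hρ.1, (div_lt_iff₀ hρ.1).2 hν.2⟩
  have hv : ρ₀ ∈ Ico (0 : ℝ) 1 := ⟨hρ.1.le, hρ.2⟩
  have h1 := hC P hP _ hu _ hv Y hY
  have hα := (hR.alpha_le P hP _ hu _ hv).2
  have e2 : ν / ρ₀ / u₀ = ν / (u₀ * ρ₀) := by rw [div_div, mul_comm]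
  have hξ1 : ν / (u₀ * ρ₀) ≤ 1 := by
    rw [← e2, div_le_one hu₀]; exact (hu.2.trans hR.lt).le
  rw [div_mul_cancel₀ _ hρ.1.ne', e2] at h1
  rw [div_mul_cancel₀ _ hρ.1.ne'] at hα
  set α := alpha σ₀ φ P ν
  have hω := compensator_nonneg (div_pos hν.1 (mul_pos hu₀ hρ.1)) hξ1 α
  have hν1 : ν ≤ 1 / 2 :=
    hν.2.le.trans ((mul_le_of_le_one_right hR.pos.le hρ.2.le).trans hR.le_half)
  have hlν : Real.log 2 ≤ |Real.log ν| := by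
    have h3 := Real.log_le_log hν.1 hν1
    rw [one_div, Real.log_inv] at h3
    rw [abs_of_neg (by linarith)]
    linarith
  have hlog : |Real.log (ν / ρ₀)| ≤ (1 + |Real.log ρ₀| / Real.log 2) * |Real.log ν| := by
    rw [Real.log_div hν.1.ne' hρ.1.ne', add_mul, one_mul]
    have h3 : |Real.log ρ₀| ≤ |Real.log ρ₀| / Real.log 2 * |Real.log ν| := by
      rw [div_mul_eq_mul_div, le_div_iff₀ hlog2]
      exact mul_le_mul_of_nonneg_left hlν (abs_nonneg _)
    linarith [abs_sub (Real.log ν) (Real.log ρ₀)]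
  have hpow : (ν / ρ₀) ^ ((p : ℝ) + q * α) ≤ ρ₀ ^ (-((p : ℝ) + 1)) * ν ^ ((p : ℝ) + q * α) := by
    rw [div_eq_mul_inv, Real.mul_rpow hν.1.le (inv_nonneg.2 hρ.1.le), mul_comm,
      Real.inv_rpow hρ.1.le, ← Real.rpow_neg hρ.1.le]
    refine mul_le_mul_of_nonneg_right ?_ (Real.rpow_nonneg hν.1.le _)
    refine Real.rpow_le_rpow_of_exponent_ge hρ.1 hρ.2.le ?_
    have h3 : (q : ℝ) * α ≤ q * |α| := mul_le_mul_of_nonneg_left (le_abs_self α) (Nat.cast_nonneg q)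
    linarith
  refine h1.trans ?_
  rw [mul_assoc C]
  refine mul_le_mul_of_nonneg_left ?_ hC0
  have hνp := Real.rpow_nonneg hν.1.le ((p : ℝ) + q * α)
  have hρp := Real.rpow_nonneg hρ.1.le (-((p : ℝ) + 1))
  calc (ν / ρ₀) ^ ((p : ℝ) + q * α) * compensator (ν / (u₀ * ρ₀)) α ^ (q + 1) * |Real.log (ν / ρ₀)|
      ≤ (ρ₀ ^ (-((p : ℝ) + 1)) * ν ^ ((p : ℝ) + q * α)) * compensator (ν / (u₀ * ρ₀)) α ^ (q + 1)
        * ((1 + |Real.log ρ₀| / Real.log 2) * |Real.log ν|) := by gcongr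
    _ = _ := by ring

end SmoothnessInVariables

/-! ### Assembly of the two cases and the two section types -/

theorem mainTheorem4 {m : ℕ} (μ₀ : EuclideanSpace ℝ (Fin m)) (σ₀ : ℝ) (hσ₀ : 0 < σ₀)
    (L : Set (Param m)) (hL : IsOpen L) (hL₀ : (μ₀, σ₀) ∈ L) (K : ℕ)
    (u₀ v₀ Y₀ : ℝ) (hu₀ : 0 < u₀) (hv₀ : 0 < v₀) (hY₀ : 0 < Y₀) :
    -- The case of irrational `σ₀`.
    (Irrational σ₀ →
      ∀ φ : Param m → Polynomial ℝ,
      IsNonresonantFamily L K φ →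
      ∃ u₁ v₁ Y₁ : ℝ, 0 < u₁ ∧ u₁ < u₀ ∧ 0 < v₁ ∧ 0 < Y₁ ∧
      ∃ N ∈ 𝓝 ((μ₀, σ₀) : Param m), N ⊆ L ∧
        (∀ P ∈ N, ∀ u ∈ Ioo 0 u₁, ∀ v ∈ Ico 0 v₁, ∀ Y ∈ Ioo (-Y₁) Y₁,
          HasTransition (nonresonantField φ P) u₀ v₀ Y₀ u v Y
            ((u / u₀) ^ (sigmaBar φ P (u * v)) * Y)) ∧
        -- First type: from `{v = ρ₀}`, parametrized by `(Y, ν)`.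
        (∀ ρ₀ ∈ Ioo 0 v₁, ∀ P ∈ N, ∀ ν ∈ Ioo 0 (u₁ * ρ₀), ∀ Y ∈ Ioo (-Y₁) Y₁,
          HasTransition (nonresonantField φ P) u₀ v₀ Y₀ (ν / ρ₀) ρ₀ Y
            ((ν / (u₀ * ρ₀)) ^ (sigmaBar φ P ν) * Y)) ∧
        -- Second type: from `{Y = Yc}`, parametrized by `(u, v)`.
        (∀ Yc ∈ Ioo (-Y₁) Y₁, ∀ P ∈ N, ∀ u ∈ Ioo 0 u₁, ∀ v ∈ Ico 0 v₁,
          HasTransition (nonresonantField φ P) u₀ v₀ Y₀ u v Yc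
            ((u / u₀) ^ (sigmaBar φ P (u * v)) * Yc))) ∧
    -- The case of rational `σ₀ = p / q`.
    (∀ p q : ℕ, 0 < q → Nat.Coprime p q → σ₀ = (p : ℝ) / (q : ℝ) →
      ∀ (φ : Param m → Polynomial ℝ)
        (Φ : Param m → MvPolynomial (Fin 2) ℝ)
        (η : Param m → Polynomial ℝ),
      IsResonantFamily q L K φ Φ η →
      ∃ u₁ v₁ Y₁ : ℝ, 0 < u₁ ∧ u₁ < u₀ ∧ 0 < v₁ ∧ 0 < Y₁ ∧
      ∃ N ∈ 𝓝 ((μ₀, σ₀) : Param m), N ⊆ L ∧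
      ∃ ψ : Param m → ℝ → ℝ → ℝ → ℝ,
        -- The transition from all points of the neighbourhood; `ψ P Y u v` is the remainder.
        (∀ P ∈ N, ∀ u ∈ Ioo 0 u₁, ∀ v ∈ Ico 0 v₁, ∀ Y ∈ Ioo (-Y₁) Y₁,
          HasTransition (resonantField p q φ Φ η P) u₀ v₀ Y₀ u v Y
            ((η P).eval (u * v) * v ^ p * (u / u₀) ^ (sigmaBar φ P (u * v))
                * compensator (u / u₀) (alpha σ₀ φ P (u * v))
              + (u / u₀) ^ (sigmaBar φ P (u * v)) * (Y + ψ P Y u v))) ∧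
        (∃ C : ℝ, ∀ P ∈ N, ∀ u ∈ Ioo 0 u₁, ∀ v ∈ Ico 0 v₁, ∀ Y ∈ Ioo (-Y₁) Y₁,
          |ψ P Y u v| ≤ C * (u ^ ((p : ℝ) + q * alpha σ₀ φ P (u * v))
            * compensator (u / u₀) (alpha σ₀ φ P (u * v)) ^ (q + 1)
            * |Real.log u|)) ∧
        (∀ l : ℕ, 2 ≤ l → ∃ u₂ ∈ Ioc 0 u₁,
          ∃ N₂ ∈ 𝓝 ((μ₀, σ₀) : Param m), N₂ ⊆ N ∧
          IsCkInVariables (A := Param m × ℝ × ℝ × ℝ)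
            (F := ℝ × ℝ × ℝ × ℝ × Param m) (l - 2)
            (fun (P, Y, u, v) => ψ P Y u v)
            (fun (P, Y, u, v) => (Y, u ^ (1 / (l : ℝ)),
              u ^ (1 / (l : ℝ))
                * compensator (u / u₀) (alpha σ₀ φ P (u * v)), v, P))
            (N₂ ×ˢ Ioo (-Y₁) Y₁ ×ˢ Ioo 0 u₂ ×ˢ Ico 0 v₁)
            (Ioo (-Y₁) Y₁ ×ˢ {0} ×ˢ {0} ×ˢ Ico 0 v₁ ×ˢ {(μ₀, σ₀)})) ∧
        -- First type: from `{v = ρ₀}`, parametrized by `(Y, ν)`; the remainder is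
        -- the restriction `ψ P Y (ν / ρ₀) ρ₀`.
        (∀ ρ₀ ∈ Ioo 0 v₁,
          (∀ P ∈ N, ∀ ν ∈ Ioo 0 (u₁ * ρ₀), ∀ Y ∈ Ioo (-Y₁) Y₁,
            HasTransition (resonantField p q φ Φ η P) u₀ v₀ Y₀
              (ν / ρ₀) ρ₀ Y
              ((η P).eval ν * ρ₀ ^ p * (ν / (u₀ * ρ₀)) ^ (sigmaBar φ P ν)
                  * compensator (ν / (u₀ * ρ₀)) (alpha σ₀ φ P ν)
                + (ν / (u₀ * ρ₀)) ^ (sigmaBar φ P ν)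
                  * (Y + ψ P Y (ν / ρ₀) ρ₀))) ∧
          (∃ C : ℝ, ∀ P ∈ N, ∀ ν ∈ Ioo 0 (u₁ * ρ₀), ∀ Y ∈ Ioo (-Y₁) Y₁,
            |ψ P Y (ν / ρ₀) ρ₀| ≤ C * (ν ^ ((p : ℝ) + q * alpha σ₀ φ P ν)
              * compensator (ν / (u₀ * ρ₀)) (alpha σ₀ φ P ν) ^ (q + 1)
              * |Real.log ν|)) ∧
          (∀ l : ℕ, 2 ≤ l → ∃ ν₂ ∈ Ioc 0 (u₁ * ρ₀),
            ∃ N₂ ∈ 𝓝 ((μ₀, σ₀) : Param m), N₂ ⊆ N ∧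
            IsCkInVariables (A := Param m × ℝ × ℝ)
              (F := ℝ × ℝ × ℝ × ℝ × Param m) (l - 2)
              (fun (P, Y, ν) => ψ P Y (ν / ρ₀) ρ₀)
              (fun (P, Y, ν) => (Y, ν ^ (1 / (l : ℝ)),
                ν ^ (1 / (l : ℝ))
                  * compensator (ν / (u₀ * ρ₀)) (alpha σ₀ φ P ν), ν, P))
              (N₂ ×ˢ Ioo (-Y₁) Y₁ ×ˢ Ioo 0 ν₂)
              (Ioo (-Y₁) Y₁ ×ˢ {0} ×ˢ {0} ×ˢ {0} ×ˢ {(μ₀, σ₀)}))) ∧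
        -- Second type: from `{Y = Yc}`, parametrized by `(u, v)`; the remainder is
        -- the restriction `ψ P Yc u v`.
        (∀ Yc ∈ Ioo (-Y₁) Y₁,
          (∀ P ∈ N, ∀ u ∈ Ioo 0 u₁, ∀ v ∈ Ico 0 v₁,
            HasTransition (resonantField p q φ Φ η P) u₀ v₀ Y₀ u v Yc
              ((η P).eval (u * v) * v ^ p * (u / u₀) ^ (sigmaBar φ P (u * v))
                  * compensator (u / u₀) (alpha σ₀ φ P (u * v))
                + (u / u₀) ^ (sigmaBar φ P (u * v)) * (Yc + ψ P Yc u v))) ∧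
          (∃ C : ℝ, ∀ P ∈ N, ∀ u ∈ Ioo 0 u₁, ∀ v ∈ Ico 0 v₁,
            |ψ P Yc u v| ≤ C * (u ^ ((p : ℝ) + q * alpha σ₀ φ P (u * v))
              * compensator (u / u₀) (alpha σ₀ φ P (u * v)) ^ (q + 1)
              * |Real.log u|)) ∧
          (∀ l : ℕ, 2 ≤ l → ∃ u₂ ∈ Ioc 0 u₁,
            ∃ N₂ ∈ 𝓝 ((μ₀, σ₀) : Param m), N₂ ⊆ N ∧
            IsCkInVariables (A := Param m × ℝ × ℝ)
              (F := ℝ × ℝ × ℝ × Param m) (l - 2)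
              (fun (P, u, v) => ψ P Yc u v)
              (fun (P, u, v) => (u ^ (1 / (l : ℝ)),
                u ^ (1 / (l : ℝ))
                  * compensator (u / u₀) (alpha σ₀ φ P (u * v)), v, P))
              (N₂ ×ˢ Ioo 0 u₂ ×ˢ Ico 0 v₁)
              ({0} ×ˢ {0} ×ˢ Ico 0 v₁ ×ˢ {(μ₀, σ₀)})))) := by
  refine ⟨fun _ φ h => ?_, fun p q hq _ hσ φ Φ η h => ?_⟩
  -- The bound |α| ≤ σ₀ is exactly what gives σ̄ ≥ 0.
  · obtain ⟨ε, hε, N, hN, H⟩ := exists_nhds_alpha_le h.smooth_phi hL hL₀ (h.phi_zero _ hL₀) hσ₀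
    set u₁ := min (u₀ / 2) ε with hu₁
    set v₁ := min v₀ 1 with hv₁
    have hlt : u₁ < u₀ := (min_le_left _ _).trans_lt (half_lt_self hu₀)
    have key : ∀ P ∈ N ∩ L, ∀ u ∈ Ioo 0 u₁, ∀ v ∈ Ico 0 v₁, ∀ Y ∈ Ioo (-Y₀) Y₀,
        HasTransition (nonresonantField φ P) u₀ v₀ Y₀ u v Y
          ((u / u₀) ^ (sigmaBar φ P (u * v)) * Y) := by
      intro P hP u hu v hv Y hY
      have hv1 : v ≤ 1 := hv.2.le.trans (min_le_right _ _)
      have huv : |u * v| < ε := by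
        rw [abs_of_nonneg (mul_nonneg hu.1.le hv.1)]
        exact (mul_le_of_le_one_right hu.1.le hv1).trans_lt (hu.2.trans_le (min_le_right _ _))
      have hα := (abs_le.1 (H P hP.1 _ huv)).1
      refine hasTransition_nonresonantField φ P hu.1 (hu.2.trans hlt) hv.1
        (hv.2.le.trans (min_le_left _ _)) (abs_le.2 ⟨hY.1.le, hY.2.le⟩) ?_
      rw [alpha] at hα
      linarith
    refine ⟨u₁, v₁, Y₀, by positivity, hlt, by positivity, hY₀, N ∩ L,
      inter_mem hN (hL.mem_nhds hL₀), inter_subset_right, key, ?_, ?_⟩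
    · intro ρ₀ hρ P hP ν hν Y hY
      have := key P hP (ν / ρ₀) ⟨div_pos hν.1 hρ.1, (div_lt_iff₀ hρ.1).2 hν.2⟩ ρ₀ ⟨hρ.1.le, hρ.2⟩
        Y hY
      rwa [div_mul_cancel₀ _ hρ.1.ne', div_div, mul_comm ρ₀ u₀] at this
    · exact fun Yc hYc P hP u hu v hv => key P hP u hu v hv Yc hYc
  · have hp : 0 < p := by
      rcases Nat.eq_zero_or_pos p with rfl | hp
      · simp [hσ] at hσ₀
      · exact hp
    obtain ⟨B, u₁, N, hN, hR⟩ := exists_isUniformRegion hL hL₀ hp hq hσ₀ hσ hu₀ hY₀ h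
    set v₁ := min v₀ 1 with hv₁
    have hv1 : ∀ v ∈ Ico 0 v₁, v ∈ Ico (0 : ℝ) 1 := fun v hv =>
      ⟨hv.1, hv.2.trans_le (min_le_right _ _)⟩
    have key : ∀ P ∈ N, ∀ u ∈ Ioo 0 u₁, ∀ v ∈ Ico 0 v₁, ∀ Y ∈ Ioo (-1 : ℝ) 1,
        HasTransition (resonantField p q φ Φ η P) u₀ v₀ Y₀ u v Y
          ((η P).eval (u * v) * v ^ p * (u / u₀) ^ (sigmaBar φ P (u * v))
              * compensator (u / u₀) (alpha σ₀ φ P (u * v))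
            + (u / u₀) ^ (sigmaBar φ P (u * v))
              * (Y + transRemainder p q K σ₀ u₀ φ Φ η P Y u v)) :=
      fun P hP u hu v hv Y hY => hR.hasTransition hq hσ h hP hu (hv1 v hv)
        (hv.2.le.trans (min_le_left _ _)) hY
    obtain ⟨C, -, hC⟩ := hR.exists_bound hp hq hσ h
    refine ⟨u₁, v₁, 1, hR.pos, hR.lt, by positivity, one_pos, N, hN, hR.subset,
      transRemainder p q K σ₀ u₀ φ Φ η, key,
      ⟨C, fun P hP u hu v hv Y hY => hC P hP u hu v (hv1 v hv) Y hY⟩, ?_, ?_, ?_⟩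
    · intro l hl
      obtain ⟨W, hW, hW₀, hWs, u₂, hu₂, N₂, hN₂, hN₂N, hD⟩ :=
        hR.exists_smooth_region hN hL hL₀ hp hq hσ h hl
      -- The map θ rescales u^(1/l) to a = (u/u₀)^(1/l) and drops the compensator coordinate.
      refine ⟨u₂, hu₂, N₂, hN₂, hN₂N, isCkInVariables_of_comp hW hWs
        (θ := fun x => (x.1, x.2.1 / u₀ ^ (1 / (l : ℝ)), x.2.2.2.1, x.2.2.2.2)) (by fun_prop) ?_ ?_⟩
      · rintro ⟨Y, a, b, v, P⟩ ⟨-, ha, -, -, hP⟩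
        simp only [mem_singleton_iff] at ha hP
        simpa [ha, hP] using hW₀ Y v
      · rintro ⟨P, Y, u, v⟩ ⟨hP, hY, hu, hv⟩
        have := hD P hP u hu v (hv1 v hv) Y hY
        rwa [Real.div_rpow hu.1.le hu₀.le] at this
    · intro ρ₀ hρ
      have hρ1 : ρ₀ ∈ Ioo (0 : ℝ) 1 := ⟨hρ.1, hρ.2.trans_le (min_le_right _ _)⟩
      refine ⟨?_, hR.exists_bound_section hp hq hσ h hρ1, ?_⟩
      · intro P hP ν hν Y hY
        have := key P hP (ν / ρ₀) ⟨div_pos hν.1 hρ.1, (div_lt_iff₀ hρ.1).2 hν.2⟩ ρ₀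
          ⟨hρ.1.le, hρ.2⟩ Y hY
        rwa [div_mul_cancel₀ _ hρ.1.ne', div_div, mul_comm ρ₀ u₀] at this
      · intro l hl
        obtain ⟨W, hW, hW₀, hWs, u₂, hu₂, N₂, hN₂, hN₂N, hD⟩ :=
          hR.exists_smooth_region hN hL hL₀ hp hq hσ h hl
        -- Here v is frozen at ρ₀ and a = (ν/(ρ₀u₀))^(1/l), so θ drops the coordinate ν as well.
        refine ⟨u₂ * ρ₀, ⟨mul_pos hu₂.1 hρ.1, mul_le_mul_of_nonneg_right hu₂.2 hρ.1.le⟩, N₂, hN₂,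
          hN₂N, isCkInVariables_of_comp hW hWs
          (θ := fun x => (x.1, x.2.1 / (ρ₀ * u₀) ^ (1 / (l : ℝ)), ρ₀, x.2.2.2.2))
          (by fun_prop) ?_ ?_⟩
        · rintro ⟨Y, a, b, v, P⟩ ⟨-, ha, -, -, hP⟩
          simp only [mem_singleton_iff] at ha hP
          simpa [ha, hP] using hW₀ Y ρ₀
        · rintro ⟨P, Y, ν⟩ ⟨hP, hY, hν⟩
          have := hD P hP (ν / ρ₀) ⟨div_pos hν.1 hρ.1, (div_lt_iff₀ hρ.1).2 hν.2⟩ ρ₀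
            ⟨hρ.1.le, hρ1.2⟩ Y hY
          rwa [div_div, Real.div_rpow hν.1.le (mul_pos hρ.1 hu₀).le] at this
    · intro Yc hYc
      refine ⟨fun P hP u hu v hv => key P hP u hu v hv Yc hYc,
        ⟨C, fun P hP u hu v hv => hC P hP u hu v (hv1 v hv) Yc hYc⟩, ?_⟩
      intro l hl
      obtain ⟨W, hW, hW₀, hWs, u₂, hu₂, N₂, hN₂, hN₂N, hD⟩ :=
        hR.exists_smooth_region hN hL hL₀ hp hq hσ h hl
      refine ⟨u₂, hu₂, N₂, hN₂, hN₂N, isCkInVariables_of_comp hW hWs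
        (θ := fun x => (Yc, x.1 / u₀ ^ (1 / (l : ℝ)), x.2.2.1, x.2.2.2)) (by fun_prop) ?_ ?_⟩
      · rintro ⟨a, b, v, P⟩ ⟨ha, -, -, hP⟩
        simp only [mem_singleton_iff] at ha hP
        simpa [ha, hP] using hW₀ Yc v
      · rintro ⟨P, u, v⟩ ⟨hP, hu, hv⟩
        have := hD P hP u hu v (hv1 v hv) Yc hYc
        rwa [Real.div_rpow hu.1.le hu₀.le] at this
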